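/- For $C^2$ functions on $\mathbb{R}$ let $$D=-\frac{1}{\cosh^2 z}\left(\partial_z^2-2\tanh z\,\partial_z+1\right),$$ and let $\langle\varphi,\psi\rangle=\int_{\mathbb{R}}\varphi\psi\,dz$. Say that a real function $\psi$ is in the domain of $D$ if $\psi\in C^2(\mathbb{R})$ and $\psi, D\psi\in L^2(\mathbb{R},dz)$; an eigenfunction with energy $E\in\mathbb{R}$ is a $\psi\neq 0$ in the domain with $D\psi=E\psi$. Then: (i) The static catenoid $r(t,z)=\cosh z$ solves the axially symmetric timelike minimal surface equation $$r''(1-\dot r^2)-\ddot r(1+r'^2)+2\dot r r'\dot r'=\frac1r\left(1+r'^2-\dot r^2\right)$$ (dots are $t$-derivatives, primes are $z$-derivatives), and the linearization of this equation around $\cosh z$ is $\ddot\epsilon+D\epsilon=0$. More precisely, for $\epsilon\in C^2(\mathbb{R}^2)$ and every $(t,z)$, the derivative at $\lambda=0$ of the left side minus the right side for $r=\cosh z+\lambda\epsilon$ is $-\cosh^2 z\,(\ddot\epsilon+D\epsilon)$. (ii) $D$ has the zero modes $\epsilon_+(z)=\cosh z-z\sinh z$ and $\epsilon_-(z)=\sinh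 z$: $D\epsilon_\pm=0$. (iii) On $C^2$ functions and for $z\neq0$, as compositions of operators, $$D=\frac1{\cosh z}\left(\partial_z+\frac1{\sinh z\cosh z}\right)\left(-\partial_z+\frac1{\sinh z\cosh z}\right)\frac1{\cosh z}=\left(\partial_z\frac1{\cosh z}+\frac1{\sinh z}\right)\left(-\frac1{\cosh z}\partial_z+\frac1{\sinh z}\right).$$ (iv) $\langle\psi,D\psi\rangle\ge0$ for every odd $\psi$ in the domain of $D$, and every odd eigenfunction of $D$ has energy $E>0$. (v) The function $\psi_0(z)=1/\cosh z$ is in the domain of $D$, and $\langle\psi_0,D\psi_0\rangle/\langle\psi_0,\psi_0\rangle=-\frac{8}{15}$. (vi) Up to scalar multiples, $D$ has exactly one even eigenfunction with negative energy, and its energy $E$ satisfies $E\le-\frac{8}{15}$. -/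

import Mathlib

/-- The operator `D = -(1/cosh² z) (∂_z² - 2 tanh z ∂_z + 1)` acting on functions of `z`. -/
noncomputable def catenoidD (ε : ℝ → ℝ) (z : ℝ) : ℝ :=
  -(1 / Real.cosh z ^ 2) *
    (deriv (deriv ε) z - 2 * Real.tanh z * deriv ε z + ε z)

/-- Left side minus right side of the equation
`r'' (1 - ṙ²) - r̈ (1 + r'²) + 2 ṙ r' ṙ' = (1 + r'² - ṙ²) / r`
for the profile `r = r(t, z)` of an axially symmetric timelike minimal hypersurface
(dots are `t`-derivatives, primes are `z`-derivatives). -/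
noncomputable def minimalResidual (r : ℝ → ℝ → ℝ) (t z : ℝ) : ℝ :=
  let rt : ℝ → ℝ → ℝ := fun t z => deriv (fun s => r s z) t
  let rz : ℝ → ℝ → ℝ := fun t z => deriv (fun x => r t x) z
  let rtt : ℝ := deriv (fun s => rt s z) t
  let rzz : ℝ := deriv (fun x => rz t x) z
  let rtz : ℝ := deriv (fun x => rt t x) z
  rzz * (1 - rt t z ^ 2) - rtt * (1 + rz t z ^ 2) + 2 * rt t z * rz t z * rtz
    - (1 + rz t z ^ 2 - rt t z ^ 2) / r t z

/-- The first order operator `σ ∂_z + 1 / (sinh z cosh z)` (used with `σ = 1` and `σ = -1`). -/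
noncomputable def firstOrderFactor (σ : ℝ) (g : ℝ → ℝ) (z : ℝ) : ℝ :=
  σ * deriv g z + 1 / (Real.sinh z * Real.cosh z) * g z

/-- The right factor `A = -(1/cosh z) ∂_z + 1 / sinh z`. -/
noncomputable def rightFactor (g : ℝ → ℝ) (z : ℝ) : ℝ :=
  -(1 / Real.cosh z) * deriv g z + 1 / Real.sinh z * g z

/-- The left factor, `h ↦ ∂_z ((1/cosh z) h) + (1 / sinh z) h`. -/
noncomputable def leftFactor (h : ℝ → ℝ) (z : ℝ) : ℝ :=
  deriv (fun x => 1 / Real.cosh x * h x) z + 1 / Real.sinh z * h z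

/-- The inner product `⟨φ, ψ⟩ = ∫ φ ψ dz` of `L²(ℝ, dz)`, for real-valued functions. -/
noncomputable def innerL2 (φ ψ : ℝ → ℝ) : ℝ := ∫ z, φ z * ψ z

/-- Functions of class `C²` on which `D` acts inside `L²(ℝ, dz)`. -/
structure InDomainD (ψ : ℝ → ℝ) : Prop where
  contDiff : ContDiff ℝ 2 ψ
  memLp : MeasureTheory.MemLp ψ 2
  memLp_D : MeasureTheory.MemLp (catenoidD ψ) 2

/-- `ψ` is an eigenfunction of `D` in `L²(ℝ, dz)` with energy `E`. -/
structure IsEigenfunctionD (E : ℝ) (ψ : ℝ → ℝ) : Prop where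
  inDomain : InDomainD ψ
  ne_zero : ψ ≠ 0
  eigen : ∀ z, catenoidD ψ z = E * ψ z

section

open Real MeasureTheory Filter Topology

/-! The operator has the Sturm–Liouville form `(ψ' / cosh²)' = -Dψ - ψ / cosh²`, so with `u = ψ' /
cosh²` the equation `Dψ = -lψ` is a linear system for `(ψ, u)`. Everything spectral is done with
this system and half-line integrals; no spectral theorem or min-max principle enters.

Positivity: with `A = rightFactor`, `ψ Dψ - (Aψ)²` is the derivative of the flux `(ψ / cosh) · Aψ`.
If `ψ a = 0` with `a ≥ 0`, the flux vanishes at `a` and cannot stay negative at infinity for `ψ ∈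
L²`, so `∫_a^∞ ψ Dψ ≥ 0` (`integral_Ioi_mul_catenoidD_nonneg`). The case `a = 0` settles odd
functions. For `E < 0` and general `a` it shows that an even eigenfunction has no zeros.

Uniqueness: two positive even eigenfunctions with different negative energies have a Wronskian that
is zero at `0`, strictly monotone, and tends to zero at infinity, which is impossible. At equal
energies, ODE uniqueness gives proportionality.

Existence is by shooting: `l₀` is the supremum of the `l > 0` whose even solution crosses zero. This
set is open, so the solution at `l₀` stays positive. A positive `u` far out would persist for nearby
`l` and keep them out of the set, so `u ≤ 0` eventually, and this forces square integrability. The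
bound `l₀ ≥ 8/15` comes from Jacobi's identity for the trial function `1 / cosh`
(`IsCatenoidSolution.le_of_pos`). -/

/-! ### Elementary derivatives and the Sturm–Liouville form. -/

theorem hasDerivAt_inv_cosh (z : ℝ) :
    HasDerivAt (fun x => 1 / cosh x) (-(sinh z / cosh z ^ 2)) z := by
  have h := (hasDerivAt_const z (1 : ℝ)).div (hasDerivAt_cosh z) (cosh_pos z).ne'
  refine h.congr_deriv ?_
  ring

theorem hasDerivAt_tanh' (z : ℝ) : HasDerivAt tanh (1 / cosh z ^ 2) z := by
  have h := (hasDerivAt_sinh z).div (hasDerivAt_cosh z) (cosh_pos z).ne'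
  have e : (sinh / cosh : ℝ → ℝ) = tanh := by
    funext x; simp [tanh_eq_sinh_div_cosh]
  rw [e] at h
  refine h.congr_deriv ?_
  have := cosh_sq z
  have hc := (cosh_pos z).ne'
  field_simp
  linarith

theorem catenoidD_eq_of_hasDerivAt {ε ε' : ℝ → ℝ} {ε'' z : ℝ}
    (h1 : ∀ x, HasDerivAt ε (ε' x) x) (h2 : HasDerivAt ε' ε'' z) :
    catenoidD ε z = -(1 / cosh z ^ 2) * (ε'' - 2 * tanh z * ε' z + ε z) := by
  have e : deriv ε = ε' := funext fun x => (h1 x).deriv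
  simp only [catenoidD, e, h2.deriv]

theorem ContDiff.hasDerivAt_deriv {ψ : ℝ → ℝ} (h : ContDiff ℝ 2 ψ) (z : ℝ) :
    HasDerivAt ψ (deriv ψ z) z :=
  (h.differentiable (by norm_num) z).hasDerivAt

theorem ContDiff.deriv_one {ψ : ℝ → ℝ} (h : ContDiff ℝ 2 ψ) : ContDiff ℝ 1 (deriv ψ) := by
  have h' : ContDiff ℝ (1 + 1) ψ := h
  exact (contDiff_succ_iff_deriv.1 h').2.2

theorem ContDiff.hasDerivAt_deriv_deriv {ψ : ℝ → ℝ} (h : ContDiff ℝ 2 ψ) (z : ℝ) :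
    HasDerivAt (deriv ψ) (deriv (deriv ψ) z) z :=
  (h.deriv_one.differentiable (by norm_num) z).hasDerivAt

theorem ContDiff.continuous_catenoidD {ψ : ℝ → ℝ} (h : ContDiff ℝ 2 ψ) :
    Continuous (catenoidD ψ) := by
  have h1 : Continuous (deriv ψ) := h.deriv_one.continuous
  have h2 : Continuous (deriv (deriv ψ)) := h.deriv_one.continuous_deriv le_rfl
  have h0 := h.continuous
  have ht : Continuous tanh :=
    continuous_iff_continuousAt.2 fun z => (hasDerivAt_tanh' z).continuousAt
  have hc : ∀ x : ℝ, Real.cosh x ^ 2 ≠ 0 := fun x => (pow_pos (cosh_pos x) 2).ne'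
  unfold catenoidD
  have hcc : Continuous Real.cosh := continuous_cosh
  exact ((continuous_const.div (hcc.pow 2) hc).neg).mul
    ((h2.sub ((continuous_const.mul ht).mul h1)).add h0)

/-- The Sturm–Liouville form of `D`. -/
theorem hasDerivAt_weighted_deriv {ψ : ℝ → ℝ} (h : ContDiff ℝ 2 ψ) (z : ℝ) :
    HasDerivAt (fun x => deriv ψ x / cosh x ^ 2) (-catenoidD ψ z - ψ z / cosh z ^ 2) z := by
  have h2 := (h.hasDerivAt_deriv_deriv z).div ((hasDerivAt_cosh z).pow 2)
    (pow_pos (cosh_pos z) 2).ne'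
  refine h2.congr_deriv ?_
  have hc := (cosh_pos z).ne'
  simp only [catenoidD, tanh_eq_sinh_div_cosh, Pi.pow_apply]
  field_simp
  ring

/-! ### The static catenoid and its linearization. -/

theorem minimalResidual_cosh (t z : ℝ) : minimalResidual (fun _ x => cosh x) t z = 0 := by
  have hc := (cosh_pos z).ne'
  have := cosh_sq z
  simp [minimalResidual, Real.deriv_cosh, Real.deriv_sinh]
  field_simp
  linarith

theorem hasDerivAt_minimalResidual {ε : ℝ → ℝ → ℝ}
    (hε : ContDiff ℝ 2 (fun p : ℝ × ℝ => ε p.1 p.2)) (t z : ℝ) :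
    HasDerivAt (fun l : ℝ => minimalResidual (fun s x => cosh x + l * ε s x) t z)
      (-cosh z ^ 2 * (deriv (deriv (fun s => ε s z)) t + catenoidD (fun x => ε t x) z)) 0 := by
  have hz : ∀ t, ContDiff ℝ 2 (fun x => ε t x) := fun t =>
    hε.comp (contDiff_const.prodMk contDiff_id)
  set a := deriv (fun s => ε s z) t with ha
  set b := deriv (fun x => ε t x) z with hb
  set att := deriv (deriv (fun s => ε s z)) t with hatt
  set bzz := deriv (deriv (fun x => ε t x)) z with hbzz
  set m := deriv (fun x => deriv (fun s => ε s x) t) z with hm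
  have dt : ∀ l t z : ℝ, deriv (fun s => cosh z + l * ε s z) t = l * deriv (fun s => ε s z) t := by
    intro l t z
    simp [deriv_const_mul_field]
  have dz : ∀ l t z : ℝ, deriv (fun x => cosh x + l * ε t x) z =
      sinh z + l * deriv (fun x => ε t x) z := fun l t z =>
    ((hasDerivAt_cosh z).add (((hz t).hasDerivAt_deriv z).const_mul l)).deriv
  have dzz : ∀ l : ℝ, deriv (fun x => sinh x + l * deriv (fun x => ε t x) x) z =
      cosh z + l * bzz := fun l =>
    ((hasDerivAt_sinh z).add (((hz t).hasDerivAt_deriv_deriv z).const_mul l)).deriv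
  -- With all derivatives of `ε` frozen at `(t, z)`, the residual is a rational function of `l`; the
  -- mixed derivative only enters at order `l²`.
  have key : ∀ l : ℝ, minimalResidual (fun s x => cosh x + l * ε s x) t z =
      (cosh z + l * bzz) * (1 - (l * a) ^ 2) - (l * att) * (1 + (sinh z + l * b) ^ 2)
        + 2 * (l * a) * (sinh z + l * b) * (l * m)
        - (1 + (sinh z + l * b) ^ 2 - (l * a) ^ 2) / (cosh z + l * ε t z) := by
    intro l
    simp only [minimalResidual, dt, dz, dzz, deriv_const_mul_field]
    rfl
  simp only [key]
  have hl := hasDerivAt_id (0 : ℝ)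
  have lin : ∀ u v : ℝ, HasDerivAt (fun l : ℝ => u + l * v) v 0 := fun u v => by
    simpa using (hl.mul_const v).const_add u
  have lin0 : ∀ v : ℝ, HasDerivAt (fun l : ℝ => l * v) v 0 := fun v => by
    simpa using hl.mul_const v
  have hc := (cosh_pos z).ne'
  have hsq := cosh_sq z
  have H := ((((lin (cosh z) bzz).mul (((lin0 a).pow 2).const_sub 1)).sub
    ((lin0 att).mul (((lin (sinh z) b).pow 2).const_add 1))).add
    ((((lin0 a).const_mul 2).mul (lin (sinh z) b)).mul (lin0 m))).sub
    (((((lin (sinh z) b).pow 2).const_add 1).sub ((lin0 a).pow 2)).div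
      (lin (cosh z) (ε t z)) (by simpa using hc))
  refine H.congr_deriv ?_
  simp only [catenoidD, tanh_eq_sinh_div_cosh, ← hbzz, ← hb, Pi.pow_apply, Pi.sub_apply,
    Pi.mul_apply, zero_mul, add_zero]
  field_simp
  have : sinh z ^ 2 = cosh z ^ 2 - 1 := by linarith
  simp only [this]
  ring

/-! ### Zero modes and factorizations. -/

theorem catenoidD_cosh_sub (z : ℝ) : catenoidD (fun x => cosh x - x * sinh x) z = 0 := by
  have h1 : ∀ x : ℝ, HasDerivAt (fun x => cosh x - x * sinh x) (-(x * cosh x)) x := fun x => by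
    refine ((hasDerivAt_cosh x).sub ((hasDerivAt_id x).mul (hasDerivAt_sinh x))).congr_deriv ?_
    simp
  have h2 : HasDerivAt (fun x : ℝ => -(x * cosh x)) (-(cosh z + z * sinh z)) z := by
    refine ((hasDerivAt_id z).mul (hasDerivAt_cosh z)).neg.congr_deriv ?_
    simp
  rw [catenoidD_eq_of_hasDerivAt h1 h2, tanh_eq_sinh_div_cosh]
  have hc := (cosh_pos z).ne'
  field_simp
  ring

theorem catenoidD_sinh (z : ℝ) : catenoidD (fun x => sinh x) z = 0 := by
  rw [catenoidD_eq_of_hasDerivAt hasDerivAt_sinh (hasDerivAt_cosh z), tanh_eq_sinh_div_cosh]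
  have hc := (cosh_pos z).ne'
  field_simp
  ring

theorem hasDerivAt_rightFactor {ψ : ℝ → ℝ} (h : ContDiff ℝ 2 ψ) {z : ℝ} (hz : z ≠ 0) :
    HasDerivAt (rightFactor ψ) (-(1 / cosh z) * deriv (deriv ψ) z +
      sinh z / cosh z ^ 2 * deriv ψ z + 1 / sinh z * deriv ψ z
        - cosh z / sinh z ^ 2 * ψ z) z := by
  have hs : sinh z ≠ 0 := sinh_ne_zero.2 hz
  have H := ((hasDerivAt_inv_cosh z).neg.mul (h.hasDerivAt_deriv_deriv z)).add
    (((hasDerivAt_const z (1 : ℝ)).div (hasDerivAt_sinh z) hs).mul (h.hasDerivAt_deriv z))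
  refine H.congr_deriv ?_
  have hc := (cosh_pos z).ne'
  simp
  field_simp
  ring

theorem catenoidD_eq_leftFactor {ε : ℝ → ℝ} (h : ContDiff ℝ 2 ε) {z : ℝ} (hz : z ≠ 0) :
    catenoidD ε z = leftFactor (rightFactor ε) z := by
  have hs : sinh z ≠ 0 := sinh_ne_zero.2 hz
  have hc := (cosh_pos z).ne'
  have H := ((hasDerivAt_inv_cosh z).mul (hasDerivAt_rightFactor h hz)).deriv
  have e : leftFactor (rightFactor ε) z = deriv ((fun x => 1 / cosh x) * rightFactor ε) z +
    1 / sinh z * rightFactor ε z := rfl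
  rw [e, H]
  simp only [rightFactor, catenoidD, tanh_eq_sinh_div_cosh]
  have hsq := cosh_sq z
  field_simp
  have : cosh z ^ 2 = sinh z ^ 2 + 1 := by linarith
  ring_nf

theorem catenoidD_eq_firstOrderFactor {ε : ℝ → ℝ} (h : ContDiff ℝ 2 ε) {z : ℝ} (hz : z ≠ 0) :
    catenoidD ε z = 1 / cosh z *
      firstOrderFactor 1 (firstOrderFactor (-1) (fun x => 1 / cosh x * ε x)) z := by
  have hs : sinh z ≠ 0 := sinh_ne_zero.2 hz
  have hc := (cosh_pos z).ne'
  -- Agreement near `z` is needed, not just at `z`, because the outer factor differentiates. It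
  -- reduces to `1 + sinh² = cosh²`.
  have e : firstOrderFactor (-1) (fun x => 1 / cosh x * ε x) =ᶠ[nhds z] rightFactor ε := by
    filter_upwards [isOpen_ne.mem_nhds hz] with x hx
    have hsx : sinh x ≠ 0 := sinh_ne_zero.2 hx
    have hcx := (cosh_pos x).ne'
    have H : deriv (fun x => 1 / cosh x * ε x) x = _ :=
      ((hasDerivAt_inv_cosh x).mul (h.hasDerivAt_deriv x)).deriv
    simp only [firstOrderFactor, rightFactor, H]
    have hsq := cosh_sq x
    field_simp
    linear_combination (-ε x) * hsq
  rw [firstOrderFactor, e.deriv_eq, e.eq_of_nhds, catenoidD_eq_leftFactor h hz]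
  have H := ((hasDerivAt_inv_cosh z).mul (hasDerivAt_rightFactor h hz)).deriv
  have e : leftFactor (rightFactor ε) z = deriv ((fun x => 1 / cosh x) * rightFactor ε) z +
    1 / sinh z * rightFactor ε z := rfl
  rw [e, H, (hasDerivAt_rightFactor h hz).deriv]
  generalize hq : -(1 / cosh z) * deriv (deriv ε) z +
      sinh z / cosh z ^ 2 * deriv ε z + 1 / sinh z * deriv ε z
        - cosh z / sinh z ^ 2 * ε z = q
  have hsq := cosh_sq z
  field_simp
  rw [hsq]
  ring

/-! ### Decay of `1 / cosh` and the trial function. -/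

theorem one_add_sq_le_cosh_sq (z : ℝ) : 1 + z ^ 2 ≤ cosh z ^ 2 := by
  rw [cosh_sq]
  have : z ^ 2 ≤ sinh z ^ 2 := by
    rcases le_total 0 z with h | h
    · exact pow_le_pow_left₀ h (self_le_sinh_iff.2 h) 2
    · have := pow_le_pow_left₀ (neg_nonneg.2 h) (self_le_sinh_iff.2 (neg_nonneg.2 h)) 2
      simpa using this
  linarith

theorem inv_cosh_sq_le_one (z : ℝ) : 1 / cosh z ^ 2 ≤ 1 := by
  rw [div_le_one (by positivity)]
  nlinarith [one_add_sq_le_cosh_sq z, sq_nonneg z]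

theorem continuous_inv_cosh : Continuous fun z : ℝ => 1 / cosh z :=
  continuous_const.div continuous_cosh fun z => (cosh_pos z).ne'

theorem continuous_inv_cosh_sq : Continuous fun z : ℝ => 1 / cosh z ^ 2 :=
  continuous_const.div (continuous_cosh.pow 2) fun z => (pow_pos (cosh_pos z) 2).ne'

theorem integrable_inv_cosh_sq : Integrable fun z : ℝ => 1 / cosh z ^ 2 := by
  refine integrable_inv_one_add_sq.mono' continuous_inv_cosh_sq.aestronglyMeasurable
    (Eventually.of_forall fun z => ?_)
  rw [norm_of_nonneg (by positivity), one_div]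
  exact inv_anti₀ (by positivity) (one_add_sq_le_cosh_sq z)

theorem tendsto_inv_cosh_sq_atTop : Tendsto (fun z : ℝ => 1 / cosh z ^ 2) atTop (𝓝 0) := by
  have h : Tendsto (fun z : ℝ => cosh z ^ 2) atTop atTop := by
    refine tendsto_atTop_mono (fun z => ?_) tendsto_id
    have := one_add_sq_le_cosh_sq z
    simp only [id]
    nlinarith [sq_nonneg (z - 1)]
  refine h.inv_tendsto_atTop.congr fun z => ?_
  simp

theorem tendsto_tanh_atTop : Tendsto tanh atTop (𝓝 1) := by
  have h : Tendsto (fun z : ℝ => 1 - exp (-z)) atTop (𝓝 1) := by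
    simpa using tendsto_const_nhds.sub (tendsto_exp_neg_atTop_nhds_zero) (a := (1 : ℝ))
  refine tendsto_of_tendsto_of_tendsto_of_le_of_le h tendsto_const_nhds (fun z => ?_)
    fun z => (tanh_lt_one z).le
  have hc := cosh_pos z
  have h1 : tanh z = 1 - exp (-z) / cosh z := by
    rw [tanh_eq_sinh_div_cosh, ← cosh_sub_sinh]
    field_simp
    ring
  have : exp (-z) / cosh z ≤ exp (-z) := div_le_self (exp_pos _).le (one_le_cosh z)
  simp only [h1]
  linarith

theorem tendsto_tanh_atBot : Tendsto tanh atBot (𝓝 (-1)) := by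
  have h := (tendsto_tanh_atTop.comp tendsto_neg_atBot_atTop).neg
  refine h.congr fun z => ?_
  simp

theorem memLp_two_of_abs_le_inv_cosh {f : ℝ → ℝ} (hf : Continuous f) (C : ℝ)
    (h : ∀ z, |f z| ≤ C * (1 / cosh z)) : MemLp f 2 := by
  refine (memLp_two_iff_integrable_sq hf.aestronglyMeasurable).2 ?_
  refine (integrable_inv_cosh_sq.const_mul (C ^ 2)).mono' (hf.pow 2).aestronglyMeasurable
    (Eventually.of_forall fun z => ?_)
  have := pow_le_pow_left₀ (abs_nonneg _) (h z) 2
  rw [norm_of_nonneg (by positivity)]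
  rw [sq_abs, mul_pow, one_div_pow] at this
  exact this

theorem contDiff_inv_cosh : ContDiff ℝ 2 fun z : ℝ => 1 / Real.cosh z :=
  contDiff_const.div Real.contDiff_cosh fun z => (cosh_pos z).ne'

theorem catenoidD_inv_cosh (z : ℝ) :
    catenoidD (fun z => 1 / cosh z) z = -4 / cosh z ^ 3 + 4 / cosh z ^ 5 := by
  have h2 : HasDerivAt (fun x : ℝ => -(sinh x / cosh x ^ 2))
      (-((cosh z * cosh z ^ 2 - sinh z * (2 * cosh z * sinh z)) / (cosh z ^ 2) ^ 2)) z := by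
    refine ((hasDerivAt_sinh z).div ((hasDerivAt_cosh z).pow 2)
      (pow_pos (cosh_pos z) 2).ne').neg.congr_deriv ?_
    simp
  rw [catenoidD_eq_of_hasDerivAt hasDerivAt_inv_cosh h2, tanh_eq_sinh_div_cosh]
  have hc := (cosh_pos z).ne'
  have hsq : sinh z ^ 2 = cosh z ^ 2 - 1 := by linarith [cosh_sq z]
  field_simp
  rw [hsq]
  ring

theorem inDomainD_inv_cosh : InDomainD fun z => 1 / cosh z where
  contDiff := contDiff_inv_cosh
  memLp := memLp_two_of_abs_le_inv_cosh continuous_inv_cosh 1 fun z => by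
    have := cosh_pos z
    rw [one_mul, abs_of_pos (by positivity)]
  memLp_D := memLp_two_of_abs_le_inv_cosh contDiff_inv_cosh.continuous_catenoidD 4 fun z => by
    have hc := cosh_pos z
    have h1 := inv_cosh_sq_le_one z
    have e : -4 / cosh z ^ 3 + 4 / cosh z ^ 5 =
        -(4 * (1 / cosh z) * ((1 / cosh z ^ 2) * (1 - 1 / cosh z ^ 2))) := by
      field_simp
      ring
    have hp : 0 < 1 / cosh z ^ 2 := by positivity
    rw [catenoidD_inv_cosh, e, abs_neg, abs_of_nonneg
      (mul_nonneg (by positivity) (mul_nonneg hp.le (by linarith)))]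
    refine mul_le_of_le_one_right (by positivity) ?_
    nlinarith

theorem integral_inv_cosh_sq : ∫ z : ℝ, 1 / cosh z ^ 2 = 2 := by
  rw [integral_of_hasDerivAt_of_tendsto hasDerivAt_tanh' integrable_inv_cosh_sq
    tendsto_tanh_atBot tendsto_tanh_atTop]
  norm_num

/-- Even powers of `1 / cosh` have odd polynomials in `tanh` as primitives. This serves both the
trial energy and the lower bound on `l`. -/
theorem hasDerivAt_tanh_polynomial (a b c z : ℝ) :
    HasDerivAt (fun x => a * tanh x + b * tanh x ^ 3 + c * tanh x ^ 5)
      (1 / cosh z ^ 2 * (a + 3 * b * tanh z ^ 2 + 5 * c * tanh z ^ 4)) z := by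
  have h := hasDerivAt_tanh' z
  refine (((h.const_mul a).add ((h.pow 3).const_mul b)).add ((h.pow 5).const_mul c)).congr_deriv ?_
  simp
  ring

theorem innerL2_inv_cosh_self : innerL2 (fun z => 1 / cosh z) (fun z => 1 / cosh z) = 2 := by
  rw [innerL2, ← integral_inv_cosh_sq]
  congr 1
  funext z
  ring

theorem innerL2_inv_cosh_catenoidD :
    innerL2 (fun z => 1 / cosh z) (catenoidD fun z => 1 / cosh z) = -(16 / 15) := by
  -- The integrand `-4 / cosh⁴ + 4 / cosh⁶` rewritten with `1 / cosh² = 1 - tanh²`; the coefficients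
  -- are arranged to match the primitive `-(4/3) tanh³ + (4/5) tanh⁵`.
  have e : ∀ z, 1 / cosh z * catenoidD (fun z => 1 / cosh z) z =
      1 / cosh z ^ 2 * (0 + 3 * (-4 / 3) * tanh z ^ 2 + 5 * (4 / 5) * tanh z ^ 4) := fun z => by
    have hc := (cosh_pos z).ne'
    have hsq : sinh z ^ 2 = cosh z ^ 2 - 1 := by linarith [cosh_sq z]
    have h4 : sinh z ^ 4 = (cosh z ^ 2 - 1) ^ 2 := by rw [← hsq]; ring
    rw [catenoidD_inv_cosh, tanh_eq_sinh_div_cosh, div_pow, div_pow, hsq, h4]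
    field_simp
    ring
  have hi := inDomainD_inv_cosh.memLp.integrable_mul inDomainD_inv_cosh.memLp_D
  rw [innerL2, integral_of_hasDerivAt_of_tendsto
    (f := fun x => 0 * tanh x + (-4 / 3) * tanh x ^ 3 + (4 / 5) * tanh x ^ 5)
    (fun z => (hasDerivAt_tanh_polynomial 0 (-4 / 3) (4 / 5) z).congr_deriv (e z).symm) hi
    (((tendsto_tanh_atBot.const_mul 0).add ((tendsto_tanh_atBot.pow 3).const_mul _)).add
      ((tendsto_tanh_atBot.pow 5).const_mul _))
    (((tendsto_tanh_atTop.const_mul 0).add ((tendsto_tanh_atTop.pow 3).const_mul _)).add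
      ((tendsto_tanh_atTop.pow 5).const_mul _))]
  norm_num

/-! ### The energy inequality on half-lines and odd functions. -/

theorem not_integrable_of_pos_le {f : ℝ → ℝ} {c R : ℝ} (hc : 0 < c)
    (h : ∀ z, R ≤ z → c ≤ f z) : ¬ Integrable f := by
  intro hf
  have h1 : IntegrableOn (fun _ : ℝ => c) (Set.Ioi R) := by
    refine hf.integrableOn.mono' aestronglyMeasurable_const ?_
    filter_upwards [ae_restrict_mem measurableSet_Ioi] with z hz
    rw [norm_of_nonneg hc.le]
    exact h z (le_of_lt hz)
  rw [integrableOn_const_iff] at h1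
  simp [hc.ne'] at h1

/-- The boundary term in the factorized energy identity. -/
noncomputable def energyFlux (ψ : ℝ → ℝ) (z : ℝ) : ℝ :=
  ψ z ^ 2 / (sinh z * cosh z) - ψ z * (deriv ψ z / cosh z ^ 2)

theorem hasDerivAt_energyFlux {ψ : ℝ → ℝ} (h : ContDiff ℝ 2 ψ) {z : ℝ} (hz : 0 < z) :
    HasDerivAt (energyFlux ψ) (ψ z * catenoidD ψ z - rightFactor ψ z ^ 2) z := by
  have hs : sinh z ≠ 0 := (sinh_pos_iff.2 hz).ne'
  have hc := (cosh_pos z).ne'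
  have hd := h.hasDerivAt_deriv z
  have H := ((hd.pow 2).div ((hasDerivAt_sinh z).mul (hasDerivAt_cosh z))
    (mul_ne_zero hs hc)).sub (hd.mul (hasDerivAt_weighted_deriv h z))
  refine H.congr_deriv ?_
  generalize catenoidD ψ z = d
  have hsq := cosh_sq z
  simp only [rightFactor, Pi.mul_apply, Pi.pow_apply]
  field_simp
  push_cast
  ring

/-- Only `a = 0` is delicate, where `1 / sinh` blows up. There `ψ² / (sinh cosh) ≤ ψ · (ψ / z)`,
which tends to `0 · ψ' 0`. -/
theorem tendsto_energyFlux {ψ : ℝ → ℝ} (h : ContDiff ℝ 2 ψ) {a : ℝ} (ha : 0 ≤ a)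
    (h0 : ψ a = 0) : Tendsto (energyFlux ψ) (𝓝[>] a) (𝓝 0) := by
  rcases ha.eq_or_lt with rfl | ha
  · have hψ : Tendsto ψ (𝓝[>] 0) (𝓝 0) := by
      simpa [h0] using (h.continuous.tendsto 0).mono_left nhdsWithin_le_nhds
    have hq : Tendsto (fun z => deriv ψ z / cosh z ^ 2) (𝓝[>] 0)
        (𝓝 (deriv ψ 0 / cosh 0 ^ 2)) :=
      ((hasDerivAt_weighted_deriv h 0).continuousAt.tendsto).mono_left nhdsWithin_le_nhds
    have hsl : Tendsto (fun z => z⁻¹ * ψ z) (𝓝[>] 0) (𝓝 (deriv ψ 0)) := by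
      have := (hasDerivAt_iff_tendsto_slope_zero.1 (h.hasDerivAt_deriv 0)).mono_left
        (nhdsWithin_mono (0 : ℝ) (fun x (hx : x ∈ Set.Ioi (0 : ℝ)) => (Set.mem_Ioi.1 hx).ne'))
      simpa [h0] using this
    have hprod : Tendsto (fun z => |ψ z * (z⁻¹ * ψ z)|) (𝓝[>] 0) (𝓝 0) := by
      simpa using (hψ.mul hsl).abs
    have h1 : Tendsto (fun z => ψ z ^ 2 / (sinh z * cosh z)) (𝓝[>] 0) (𝓝 0) := by
      refine tendsto_of_tendsto_of_tendsto_of_le_of_le' tendsto_const_nhds hprod ?_ ?_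
      · filter_upwards [self_mem_nhdsWithin] with z (hz : 0 < z)
        have := sinh_pos_iff.2 hz
        have := cosh_pos z
        positivity
      · filter_upwards [self_mem_nhdsWithin] with z (hz : 0 < z)
        have hs : z ≤ sinh z * cosh z := by
          have := self_le_sinh_iff.2 hz.le
          nlinarith [one_le_cosh z]
        refine le_trans ?_ (le_abs_self _)
        have : ψ z * (z⁻¹ * ψ z) = ψ z ^ 2 / z := by ring
        rw [this]
        exact div_le_div_of_nonneg_left (sq_nonneg _) hz hs
    have := h1.sub (hψ.mul hq)
    rw [zero_mul, sub_zero] at this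
    exact this
  · have := (hasDerivAt_energyFlux h ha).continuousAt.tendsto.mono_left
      (nhdsWithin_le_nhds (s := Set.Ioi a))
    simpa [energyFlux, h0] using this

/-- An eventually negative flux would force `ψ ψ' > 0`, so `ψ²` would increase from a positive
value, against `ψ ∈ L²`. This replaces any decay estimate for `ψ'`. -/
theorem frequently_energyFlux_nonneg {ψ : ℝ → ℝ} (h : ContDiff ℝ 2 ψ) (hL : MemLp ψ 2) :
    ∃ᶠ z in atTop, 0 ≤ energyFlux ψ z := by
  intro hev
  obtain ⟨R, hR⟩ := eventually_atTop.1 (hev.and (eventually_gt_atTop 0))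
  have hpos : ∀ z, R ≤ z → 0 < ψ z * deriv ψ z := fun z hz => by
    obtain ⟨h1, h2⟩ := hR z hz
    have hs := sinh_pos_iff.2 h2
    have hc := cosh_pos z
    rw [not_le, energyFlux, sub_neg] at h1
    have h3 : 0 ≤ ψ z ^ 2 / (sinh z * cosh z) := by positivity
    have h4 : 0 < ψ z * deriv ψ z / cosh z ^ 2 := by
      rw [mul_div_assoc]
      linarith
    exact (div_pos_iff_of_pos_right (by positivity)).1 h4
  have hmono : MonotoneOn (fun z => ψ z ^ 2) (Set.Ici R) := by
    refine monotoneOn_of_hasDerivWithinAt_nonneg (f' := fun z => 2 * (ψ z * deriv ψ z))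
      (convex_Ici R) (h.continuous.pow 2).continuousOn (fun z _ => ?_) fun z hz => ?_
    · refine HasDerivAt.hasDerivWithinAt (((h.hasDerivAt_deriv z).pow 2).congr_deriv ?_)
      simp
      ring
    · rw [interior_Ici] at hz
      linarith [hpos z (le_of_lt hz)]
  have hR0 : ψ R ≠ 0 := left_ne_zero_of_mul (hpos R le_rfl).ne'
  exact not_integrable_of_pos_le (c := ψ R ^ 2) (by positivity)
    (fun z hz => hmono Set.self_mem_Ici hz hz) hL.integrable_sq

theorem integral_Ioi_mul_catenoidD_nonneg {ψ : ℝ → ℝ} (hψ : InDomainD ψ) {a : ℝ} (ha : 0 ≤ a)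
    (h0 : ψ a = 0) : 0 ≤ ∫ z in Set.Ioi a, ψ z * catenoidD ψ z := by
  have h := hψ.contDiff
  have hcont : Continuous fun z => ψ z * catenoidD ψ z := h.continuous.mul h.continuous_catenoidD
  have hint : Integrable fun z => ψ z * catenoidD ψ z := hψ.memLp.integrable_mul hψ.memLp_D
  have hF : ∀ z, HasDerivAt (fun z => ∫ x in a..z, ψ x * catenoidD ψ x)
      (ψ z * catenoidD ψ z) z := fun z =>
    intervalIntegral.integral_hasDerivAt_right (hcont.intervalIntegrable _ _)
      hcont.aestronglyMeasurable.stronglyMeasurableAtFilter hcont.continuousAt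
  -- `G' = (Aψ)²` and `G → 0` at `a`, so `G ≥ 0`. Wherever the flux is nonnegative the partial
  -- integral is too, and since the integral converges, frequently is enough.
  set G : ℝ → ℝ := fun z => (∫ x in a..z, ψ x * catenoidD ψ x) - energyFlux ψ z with hG
  have hG' : ∀ z, a < z → HasDerivAt G (rightFactor ψ z ^ 2) z := fun z hz =>
    ((hF z).sub (hasDerivAt_energyFlux h (ha.trans_lt hz))).congr_deriv (by ring)
  have hmono : MonotoneOn G (Set.Ioi a) := by
    refine monotoneOn_of_hasDerivWithinAt_nonneg (f' := fun z => rightFactor ψ z ^ 2)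
      (convex_Ioi a) (fun z hz => (hG' z hz).continuousAt.continuousWithinAt)
      (fun z hz => ?_) fun z _ => sq_nonneg _
    rw [interior_Ioi] at hz
    exact (hG' z hz).hasDerivWithinAt
  have hlim : Tendsto G (𝓝[>] a) (𝓝 0) := by
    have h1 : Tendsto (fun z => ∫ x in a..z, ψ x * catenoidD ψ x) (𝓝[>] a) (𝓝 0) := by
      simpa using ((hF a).continuousAt.tendsto).mono_left nhdsWithin_le_nhds
    simpa using h1.sub (tendsto_energyFlux h ha h0)
  have hG0 : ∀ z, a < z → 0 ≤ G z := fun z hz => by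
    refine le_of_tendsto hlim ?_
    filter_upwards [Ioo_mem_nhdsGT hz] with x hx
    exact hmono hx.1 hz hx.2.le
  refine ge_of_tendsto_of_frequently
    (intervalIntegral_tendsto_integral_Ioi a hint.integrableOn tendsto_id) ?_
  refine ((frequently_energyFlux_nonneg h hψ.memLp).and_eventually
    (eventually_gt_atTop a)).mono fun z hz => ?_
  have := hG0 z hz.2
  simp only [hG] at this
  simp only [id]
  linarith [hz.1]

theorem Function.Odd.catenoidD_neg {ψ : ℝ → ℝ} (h : Function.Odd ψ) (z : ℝ) :
    catenoidD ψ (-z) = -catenoidD ψ z := by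
  have e : ψ = fun x => -ψ (-x) := funext fun x => by rw [h x, neg_neg]
  have h1 : ∀ x, deriv ψ (-x) = deriv ψ x := fun x => by
    conv_rhs => rw [e]
    rw [deriv.fun_neg, deriv_comp_neg, neg_neg]
  have h2 : deriv (deriv ψ) (-z) = -deriv (deriv ψ) z := by
    have e1 : deriv ψ = fun x => deriv ψ (-x) := funext fun x => (h1 x).symm
    conv_rhs => rw [e1]
    rw [deriv_comp_neg, neg_neg]
  simp only [catenoidD, h1, h2, h z, cosh_neg, tanh_neg]
  ring

theorem integral_eq_two_mul_of_even {f : ℝ → ℝ} (h : Function.Even f) :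
    ∫ z, f z = 2 * ∫ z in Set.Ioi (0 : ℝ), f z := by
  rw [← integral_comp_abs]
  congr 1
  funext z
  rcases abs_choice z with hz | hz <;> rw [hz]
  rw [h z]

theorem innerL2_catenoidD_nonneg_of_odd {ψ : ℝ → ℝ} (hψ : InDomainD ψ) (ho : Function.Odd ψ) :
    0 ≤ innerL2 ψ (catenoidD ψ) := by
  have h0 : ψ 0 = 0 := ho.map_zero
  rw [innerL2, integral_eq_two_mul_of_even fun z => by rw [ho z, ho.catenoidD_neg]; ring]
  exact mul_nonneg zero_le_two (integral_Ioi_mul_catenoidD_nonneg hψ le_rfl h0)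

theorem Continuous.eqOn_zero_of_integral_sq {ψ : ℝ → ℝ} (hc : Continuous ψ) (hL : MemLp ψ 2)
    {a : ℝ} (h : ∫ z in Set.Ioi a, ψ z ^ 2 = 0) : Set.EqOn ψ 0 (Set.Ici a) := by
  have h1 := (setIntegral_eq_zero_iff_of_nonneg_ae (s := Set.Ioi a)
    (Eventually.of_forall fun z => sq_nonneg (ψ z)) hL.integrable_sq.integrableOn).1 h
  have h2 : Set.EqOn ψ 0 (Set.Ioi a) := by
    refine Measure.eqOn_open_of_ae_eq (μ := volume) ?_ isOpen_Ioi hc.continuousOn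
      continuousOn_const
    filter_upwards [h1] with z hz
    simpa using hz
  have := h2.closure hc continuous_const
  rwa [closure_Ioi] at this

/-- On `(a, ∞)` the energy `E ∫ ψ²` is nonnegative by the half-line inequality, so `E < 0` forces `∫
ψ² = 0`. -/
theorem IsEigenfunctionD.eqOn_zero_of_neg {E : ℝ} {ψ : ℝ → ℝ} (h : IsEigenfunctionD E ψ)
    (hE : E < 0) {a : ℝ} (ha : 0 ≤ a) (h0 : ψ a = 0) : Set.EqOn ψ 0 (Set.Ici a) := by
  refine h.inDomain.contDiff.continuous.eqOn_zero_of_integral_sq h.inDomain.memLp ?_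
  have h1 := integral_Ioi_mul_catenoidD_nonneg h.inDomain ha h0
  have e : ∀ z, ψ z * catenoidD ψ z = E * ψ z ^ 2 := fun z => by rw [h.eigen]; ring
  simp only [e, integral_const_mul] at h1
  have h2 : 0 ≤ ∫ z in Set.Ioi a, ψ z ^ 2 := integral_nonneg fun z => sq_nonneg _
  nlinarith

theorem Function.Odd.eq_zero_of_eqOn {ψ : ℝ → ℝ} (h : Function.Odd ψ)
    (h0 : Set.EqOn ψ 0 (Set.Ici 0)) : ψ = 0 := by
  funext z
  rcases le_total 0 z with hz | hz
  · exact h0 hz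
  · have := h0 (show -z ∈ Set.Ici (0 : ℝ) from neg_nonneg.2 hz)
    rw [h z] at this
    simpa using this

theorem IsEigenfunctionD.energy_pos_of_odd {E : ℝ} {ψ : ℝ → ℝ} (h : IsEigenfunctionD E ψ)
    (ho : Function.Odd ψ) : 0 < E := by
  have h0 : ψ 0 = 0 := ho.map_zero
  have hC := h.inDomain.contDiff
  rcases lt_trichotomy E 0 with hE | rfl | hE
  · exact absurd (ho.eq_zero_of_eqOn (h.eqOn_zero_of_neg hE le_rfl h0)) h.ne_zero
  · exfalso
    have hD : ∀ z, catenoidD ψ z = 0 := fun z => by rw [h.eigen, zero_mul]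
    -- The weighted Wronskian of `ψ` with the zero mode `sinh` is constant and vanishes at `0`.
    -- Hence `ψ` is a multiple of `sinh` on `z > 0`, which is not in `L²` unless it is zero.
    have hW : ∀ z, deriv ψ z / cosh z ^ 2 * sinh z - ψ z * (1 / cosh z) = 0 := by
      have hd : ∀ z, HasDerivAt
          (fun z => deriv ψ z / cosh z ^ 2 * sinh z - ψ z * (1 / cosh z)) 0 z := fun z => by
        refine (((hasDerivAt_weighted_deriv hC z).mul (hasDerivAt_sinh z)).sub
          ((hC.hasDerivAt_deriv z).mul (hasDerivAt_inv_cosh z))).congr_deriv ?_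
        have hc := (cosh_pos z).ne'
        rw [hD]
        field_simp
        ring
      intro z
      have := is_const_of_deriv_eq_zero (fun z => (hd z).differentiableAt)
        (fun z => (hd z).deriv) z 0
      simpa [h0] using this
    have hpos : ∀ z, 0 < z → HasDerivAt (fun z => ψ z / sinh z) 0 z := fun z hz => by
      have hs : sinh z ≠ 0 := (sinh_pos_iff.2 hz).ne'
      have hc := (cosh_pos z).ne'
      refine ((hC.hasDerivAt_deriv z).div (hasDerivAt_sinh z) hs).congr_deriv ?_
      have := hW z
      field_simp at this
      field_simp
      linarith
    have hconst : ∀ z, 0 < z → ψ z / sinh z = ψ 1 / sinh 1 := fun z hz =>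
      isOpen_Ioi.is_const_of_deriv_eq_zero (s := Set.Ioi (0 : ℝ)) isPreconnected_Ioi
        (fun x hx => (hpos x hx).differentiableAt.differentiableWithinAt)
        (fun x hx => (hpos x hx).deriv) hz (Set.mem_Ioi.2 one_pos)
    have hs1 := sinh_pos_iff.2 one_pos
    by_cases h1 : ψ 1 = 0
    · refine h.ne_zero (ho.eq_zero_of_eqOn fun z hz => ?_)
      rcases (show (0 : ℝ) ≤ z from hz).eq_or_lt with rfl | hz
      · simpa using h0
      · have := hconst z hz
        rw [h1, zero_div, div_eq_zero_iff] at this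
        exact this.resolve_right (sinh_pos_iff.2 hz).ne'
    · refine not_integrable_of_pos_le (R := 1) (c := ψ 1 ^ 2) (by positivity) (fun z hz => ?_)
        h.inDomain.memLp.integrable_sq
      have hz0 : 0 < z := by linarith
      have hs := sinh_pos_iff.2 hz0
      have e : ψ z = ψ 1 * (sinh z / sinh 1) := by
        have := hconst z hz0
        field_simp at this
        field_simp
        linarith
      have h1 : 1 ≤ sinh z / sinh 1 := (one_le_div hs1).2 (sinh_le_sinh.2 hz)
      rw [e, mul_pow]
      exact le_mul_of_one_le_right (sq_nonneg _) (one_le_pow₀ h1)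
  · exact hE

/-! ### Linear ODEs: global existence, uniqueness, dependence on a parameter. -/

section LinearODE

variable {E : Type*} [NormedAddCommGroup E] [NormedSpace ℝ E]

/-- The terms of the Volterra series of the linear equation `y' = A y`, `y 0 = x₀`. -/
noncomputable def volterraTerm (A : ℝ → E →L[ℝ] E) (x₀ : E) : ℕ → ℝ → E
  | 0 => fun _ => x₀
  | n + 1 => fun t => ∫ s in (0 : ℝ)..t, A s (volterraTerm A x₀ n s)

theorem continuous_volterraTerm {A : ℝ → E →L[ℝ] E} (hA : Continuous A) (x₀ : E) (n : ℕ) :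
    Continuous (volterraTerm A x₀ n) := by
  induction n with
  | zero => exact continuous_const
  | succ n ih =>
    exact intervalIntegral.continuous_primitive
      (fun a b => (hA.clm_apply ih).intervalIntegrable a b) 0

theorem hasDerivAt_volterraTerm_succ [CompleteSpace E] {A : ℝ → E →L[ℝ] E} (hA : Continuous A)
    (x₀ : E) (n : ℕ) (t : ℝ) :
    HasDerivAt (volterraTerm A x₀ (n + 1)) (A t (volterraTerm A x₀ n t)) t := by
  have hc := hA.clm_apply (continuous_volterraTerm hA x₀ n)
  exact intervalIntegral.integral_hasDerivAt_right (hc.intervalIntegrable _ _)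
    hc.aestronglyMeasurable.stronglyMeasurableAtFilter hc.continuousAt

theorem norm_volterraTerm_le {A : ℝ → E →L[ℝ] E} (x₀ : E)
    {K R : ℝ} (hK : 0 ≤ K) (hAK : ∀ t, |t| ≤ R → ‖A t‖ ≤ K) (n : ℕ) :
    ∀ t, |t| ≤ R → ‖volterraTerm A x₀ n t‖ ≤ ‖x₀‖ * ((K * |t|) ^ n / n.factorial) := by
  induction n with
  | zero => intro t _; simp [volterraTerm]
  | succ n ih =>
    intro t ht
    have hb : ∀ᵐ s ∂volume.restrict (Set.uIoc 0 t), ‖A s (volterraTerm A x₀ n s)‖ ≤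
        (K * ‖x₀‖ * K ^ n / n.factorial) * |s - 0| ^ n := by
      filter_upwards [ae_restrict_mem measurableSet_uIoc] with s hs
      have hst : |s| ≤ |t| := by
        have := Set.abs_sub_left_of_mem_uIcc (Set.uIoc_subset_uIcc hs)
        simpa using this
      have hsR := hst.trans ht
      calc ‖A s (volterraTerm A x₀ n s)‖ ≤ ‖A s‖ * ‖volterraTerm A x₀ n s‖ :=
            (A s).le_opNorm _
        _ ≤ K * (‖x₀‖ * ((K * |s|) ^ n / n.factorial)) :=
            mul_le_mul (hAK s hsR) (ih s hsR) (norm_nonneg _) hK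
        _ = _ := by rw [sub_zero, mul_pow]; ring
    refine (intervalIntegral.norm_integral_le_abs_of_norm_le hb
      (Continuous.intervalIntegrable (by fun_prop) _ _)).trans_eq ?_
    rw [intervalIntegral.integral_const_mul, abs_mul, intervalIntegral.abs_intervalIntegral_eq,
      integral_pow_abs_sub_uIoc, abs_of_nonneg (by positivity), abs_of_nonneg (by positivity),
      sub_zero, Nat.factorial_succ, mul_pow]
    push_cast
    field_simp
    ring

/-- The factorial bound makes the Volterra series and its termwise derivatives converge uniformly on
every ball, so the solution is defined on all of `ℝ` at once. -/
theorem exists_forall_hasDerivAt_linear [CompleteSpace E] {A : ℝ → E →L[ℝ] E}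
    (hA : Continuous A) (x₀ : E) : ∃ y : ℝ → E, y 0 = x₀ ∧ ∀ t, HasDerivAt y (A t (y t)) t := by
  refine ⟨fun t => ∑' n, volterraTerm A x₀ n t, ?_, fun t => ?_⟩
  · change ∑' n, volterraTerm A x₀ n 0 = x₀
    rw [tsum_eq_single 0 fun n hn => ?_]
    · rfl
    · obtain ⟨m, rfl⟩ := Nat.exists_eq_succ_of_ne_zero hn
      simp [volterraTerm]
  set R := |t| + 1 with hR
  obtain ⟨K, hK⟩ := (isCompact_Icc (a := -R) (b := R)).exists_bound_of_continuousOn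
    hA.continuousOn
  have hAK : ∀ s, |s| ≤ R → ‖A s‖ ≤ K := fun s hs => hK s (abs_le.1 hs)
  have hK0 : 0 ≤ K := (norm_nonneg _).trans (hAK 0 (by rw [abs_zero]; positivity))
  have hbound : ∀ n s, |s| ≤ R →
      ‖volterraTerm A x₀ n s‖ ≤ ‖x₀‖ * ((K * R) ^ n / n.factorial) := fun n s hs => by
    refine (norm_volterraTerm_le x₀ hK0 hAK n s hs).trans ?_
    have : 0 ≤ R := (abs_nonneg s).trans hs
    gcongr
  have hsum : Summable fun n : ℕ => ‖x₀‖ * ((K * R) ^ n / n.factorial) :=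
    (Real.summable_pow_div_factorial (K * R)).mul_left _
  have hsumt : ∀ s, |s| ≤ R → Summable fun n => volterraTerm A x₀ n s := fun s hs =>
    hsum.of_norm_bounded fun n => hbound n s hs
  have ht : |t| ≤ R := by rw [hR]; linarith
  have hmem : ∀ s, s ∈ Metric.ball (0 : ℝ) R → |s| ≤ R := fun s hs => by
    rw [Metric.mem_ball, dist_zero_right, norm_eq_abs] at hs
    exact hs.le
  have htb : t ∈ Metric.ball (0 : ℝ) R := by
    rw [Metric.mem_ball, dist_zero_right, norm_eq_abs, hR]
    linarith
  have H : HasDerivAt (fun z => ∑' n, volterraTerm A x₀ (n + 1) z)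
      (∑' n, A t (volterraTerm A x₀ n t)) t :=
    hasDerivAt_tsum_of_isPreconnected (hsum.mul_left K) Metric.isOpen_ball
      (convex_ball 0 R).isPreconnected
      (fun n s _ => hasDerivAt_volterraTerm_succ hA x₀ n s)
      (fun n s hs => ((A s).le_opNorm _).trans
        (mul_le_mul (hAK s (hmem s hs)) (hbound n s (hmem s hs)) (norm_nonneg _) hK0))
      htb ((summable_nat_add_iff 1).2 (hsumt t ht)) htb
  rw [← (A t).map_tsum (hsumt t ht)] at H
  refine (H.const_add x₀).congr_of_eventuallyEq ?_
  filter_upwards [Metric.isOpen_ball.mem_nhds htb] with s hs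
  exact (hsumt s (hmem s hs)).tsum_eq_zero_add

theorem exists_norm_le_of_continuous {F : Type*} [NormedAddCommGroup F] {A : ℝ → F}
    (hA : Continuous A) (a b : ℝ) : ∃ K : ℝ, 0 ≤ K ∧ ∀ t ∈ Set.Icc a b, ‖A t‖ ≤ K := by
  obtain ⟨K, hK⟩ := (isCompact_Icc (a := a) (b := b)).exists_bound_of_continuousOn
    hA.continuousOn
  exact ⟨max K 0, le_max_right _ _, fun t ht => (hK t ht).trans (le_max_left _ _)⟩

theorem eq_zero_of_hasDerivAt_linear {A : ℝ → E →L[ℝ] E} (hA : Continuous A) {y : ℝ → E}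
    (hy : ∀ t, HasDerivAt y (A t (y t)) t) {t₀ : ℝ} (h0 : y t₀ = 0) : y = 0 := by
  funext t
  set R := max |t| |t₀| + 1
  obtain ⟨K, hK0, hK⟩ := exists_norm_le_of_continuous hA (-R) R
  have h := ODE_solution_unique_of_mem_Ioo (v := fun t x => A t x) (s := fun _ => Set.univ)
    (K := K.toNNReal) (a := -R) (b := R) (t₀ := t₀) (f := y) (g := fun _ => 0)
    (fun t ht => (LipschitzWith.weaken (A t).lipschitz
      (by rw [← NNReal.coe_le_coe, coe_nnnorm, Real.coe_toNNReal _ hK0]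
          exact hK t (Set.Ioo_subset_Icc_self ht))).lipschitzOnWith)
    (abs_lt.1 (by linarith [le_max_right |t| |t₀|]))
    (fun t _ => ⟨hy t, trivial⟩)
    (fun t _ => ⟨by simpa using hasDerivAt_const t (0 : E), trivial⟩) h0
  exact h (abs_lt.1 (by linarith [le_max_left |t| |t₀|]))

/-- Grönwall: `y l₀` solves the equation for `l` up to an error `|l - l₀| * C`, where `C` bounds `y
l₀` on `[0, R]`. For `|l - l₀| < 1` the Lipschitz constant `M + 1` does not depend on `l`. -/
theorem eventually_dist_lt_of_hasDerivAt_linear {A : ℝ → ℝ → E →L[ℝ] E} {y : ℝ → ℝ → E} {x₀ : E}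
    {l₀ : ℝ} (hA : Continuous (A l₀)) (hAl : ∀ l t, ‖A l t - A l₀ t‖ ≤ |l - l₀|)
    (hy0 : ∀ l, y l 0 = x₀) (hy : ∀ l t, HasDerivAt (y l) (A l t (y l t)) t)
    (R : ℝ) {η : ℝ} (hη : 0 < η) :
    ∀ᶠ l in 𝓝 l₀, ∀ t ∈ Set.Icc 0 R, dist (y l t) (y l₀ t) < η := by
  obtain ⟨M, hM0, hM⟩ := exists_norm_le_of_continuous hA 0 R
  have hyc : ∀ l, Continuous (y l) := fun l =>
    continuous_iff_continuousAt.2 fun t => (hy l t).continuousAt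
  obtain ⟨C, hC0, hC⟩ := exists_norm_le_of_continuous (hyc l₀) 0 R
  have hlim : Tendsto (fun l => gronwallBound 0 (M + 1) (0 + |l - l₀| * C) R) (𝓝 l₀) (𝓝 0) := by
    have hc : Continuous fun l => gronwallBound 0 (M + 1) (0 + |l - l₀| * C) R :=
      (gronwallBound_continuous_ε 0 (M + 1) R).comp (by fun_prop)
    have := hc.tendsto l₀
    simpa [gronwallBound_ε0] using this
  filter_upwards [hlim.eventually_lt_const hη, Metric.ball_mem_nhds l₀ one_pos] with l hl hl1 t ht
  rw [Metric.mem_ball, Real.dist_eq] at hl1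
  have hK : ∀ t ∈ Set.Ico 0 R, LipschitzOnWith (M + 1).toNNReal (fun x => A l t x) Set.univ :=
    fun t ht => (LipschitzWith.weaken (A l t).lipschitz (by
      rw [← NNReal.coe_le_coe, coe_nnnorm, Real.coe_toNNReal _ (by linarith)]
      calc ‖A l t‖ = ‖A l₀ t + (A l t - A l₀ t)‖ := by rw [add_sub_cancel]
        _ ≤ ‖A l₀ t‖ + ‖A l t - A l₀ t‖ := norm_add_le _ _
        _ ≤ M + 1 := add_le_add (hM t (Set.Ico_subset_Icc_self ht))
          ((hAl l t).trans hl1.le))).lipschitzOnWith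
  have h := dist_le_of_approx_trajectories_ODE_of_mem (v := fun t x => A l t x)
    (s := fun _ => Set.univ) (δ := 0) (εf := 0) (εg := |l - l₀| * C) hK
    (hyc l).continuousOn (fun t _ => (hy l t).hasDerivWithinAt) (fun t _ => by rw [dist_self])
    (fun _ _ => trivial) (hyc l₀).continuousOn (fun t _ => (hy l₀ t).hasDerivWithinAt)
    (fun t ht => by
      rw [dist_comm, dist_eq_norm, ← _root_.sub_apply]
      exact ((A l t - A l₀ t).le_opNorm _).trans (mul_le_mul (hAl l t)
        (hC t (Set.Ico_subset_Icc_self ht)) (norm_nonneg _) (abs_nonneg _)))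
    (fun _ _ => trivial) (by rw [hy0, hy0, dist_self]) t ht
  refine h.trans_lt (lt_of_le_of_lt ?_ hl)
  rw [Real.coe_toNNReal _ (by linarith)]
  exact gronwallBound_mono le_rfl (by positivity) (by linarith) (by linarith [ht.2])

end LinearODE

/-! ### The eigenvalue equation as a first order system. -/

/-- The first order system for `(ψ, ψ' / cosh²)` equivalent to `D ψ = -l ψ`. -/
noncomputable def catenoidSystem (l t : ℝ) : ℝ × ℝ →L[ℝ] ℝ × ℝ :=
  (cosh t ^ 2 • ContinuousLinearMap.snd ℝ ℝ ℝ).prod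
    ((l - 1 / cosh t ^ 2) • ContinuousLinearMap.fst ℝ ℝ ℝ)

@[simp]
theorem catenoidSystem_apply (l t : ℝ) (x : ℝ × ℝ) :
    catenoidSystem l t x = (cosh t ^ 2 * x.2, (l - 1 / cosh t ^ 2) * x.1) := rfl

theorem continuous_catenoidSystem (l : ℝ) : Continuous (catenoidSystem l) :=
  continuous_clm_apply.2 fun _ => ((continuous_cosh.pow 2).mul continuous_const).prodMk
    ((continuous_const.sub continuous_inv_cosh_sq).mul continuous_const)

theorem norm_catenoidSystem_sub_le (l l' t : ℝ) :
    ‖catenoidSystem l t - catenoidSystem l' t‖ ≤ |l - l'| := by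
  refine ContinuousLinearMap.opNorm_le_bound _ (abs_nonneg _) fun x => ?_
  have e : (catenoidSystem l t - catenoidSystem l' t) x = (0, (l - l') * x.1) := by
    rw [_root_.sub_apply]
    ext
    · simp
    · simp
      ring
  rw [e, Prod.norm_mk, norm_zero, max_eq_right (norm_nonneg _), norm_mul, norm_eq_abs]
  exact mul_le_mul_of_nonneg_left (norm_fst_le x) (abs_nonneg _)

theorem ContDiff.hasDerivAt_catenoidSystem {E : ℝ} {ψ : ℝ → ℝ} (h : ContDiff ℝ 2 ψ)
    (hE : ∀ z, catenoidD ψ z = E * ψ z) (z : ℝ) :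
    HasDerivAt (fun z => (ψ z, deriv ψ z / Real.cosh z ^ 2))
      (catenoidSystem (-E) z (ψ z, deriv ψ z / Real.cosh z ^ 2)) z := by
  refine ((h.hasDerivAt_deriv z).prodMk (hasDerivAt_weighted_deriv h z)).congr_deriv ?_
  have hc := (cosh_pos z).ne'
  rw [catenoidSystem_apply, hE]
  ext
  · simp
    field_simp
  · simp
    ring

theorem Function.Even.deriv_zero {ψ : ℝ → ℝ} (h : Function.Even ψ) : deriv ψ 0 = 0 := by
  have e : ψ = fun x => ψ (-x) := funext fun x => (h x).symm
  have h1 : deriv ψ 0 = -deriv ψ 0 := by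
    conv_lhs => rw [e]
    rw [deriv_comp_neg, neg_zero]
  linarith

/-- By evenness a zero may be taken at `|z| ≥ 0`, and then `ψ` vanishes beyond it. Its Cauchy data
at `|z| + 1` are zero, and ODE uniqueness gives `ψ = 0`. -/
theorem IsEigenfunctionD.ne_zero_of_even {E : ℝ} {ψ : ℝ → ℝ} (h : IsEigenfunctionD E ψ)
    (hE : E < 0) (he : Function.Even ψ) (z : ℝ) : ψ z ≠ 0 := by
  intro hz
  have hz' : ψ |z| = 0 := by
    rcases abs_choice z with h | h <;> rw [h]
    · exact hz
    · rw [he z, hz]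
  have h0 := h.eqOn_zero_of_neg hE (abs_nonneg z) hz'
  have hd : deriv ψ (|z| + 1) = 0 := by
    have e : ψ =ᶠ[𝓝 (|z| + 1)] fun _ => 0 := by
      filter_upwards [Ioi_mem_nhds (lt_add_one |z|)] with x hx
      exact h0 (Set.mem_Ici.2 (le_of_lt hx))
    rw [e.deriv_eq, deriv_const]
  have hψ1 : ψ (|z| + 1) = 0 := h0 (by simp)
  have := eq_zero_of_hasDerivAt_linear (continuous_catenoidSystem (-E))
    (h.inDomain.contDiff.hasDerivAt_catenoidSystem h.eigen) (t₀ := |z| + 1) (by simp [hd, hψ1])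
  exact h.ne_zero (funext fun x => congrArg Prod.fst (congrFun this x))

theorem Continuous.pos_of_ne_zero {f : ℝ → ℝ} {a : ℝ} (hf : Continuous f) (ha : 0 < f a)
    (hne : ∀ z, a ≤ z → f z ≠ 0) {z : ℝ} (hz : a ≤ z) : 0 < f z := by
  by_contra hcon
  obtain ⟨x, hx, hx0⟩ := intermediate_value_Icc' hz hf.continuousOn ⟨not_lt.1 hcon, ha.le⟩
  exact hne x hx.1 hx0

theorem exists_nonpos_of_deriv_le {f f' : ℝ → ℝ} {c R : ℝ} (hc : 0 < c)
    (hf : ∀ z, HasDerivAt f (f' z) z) (hf' : ∀ z, R ≤ z → f' z ≤ -c) :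
    ∃ z, R ≤ z ∧ f z ≤ 0 := by
  have hanti : AntitoneOn (fun z => f z + c * z) (Set.Ici R) := by
    have hd : ∀ z, HasDerivAt (fun z => f z + c * z) (f' z + c) z := fun z =>
      ((hf z).add ((hasDerivAt_id z).const_mul c)).congr_deriv (by simp)
    refine antitoneOn_of_hasDerivWithinAt_nonpos (convex_Ici R)
      (fun z _ => (hd z).continuousAt.continuousWithinAt)
      (fun z _ => (hd z).hasDerivWithinAt) fun z hz => ?_
    rw [interior_Ici] at hz
    linarith [hf' z (le_of_lt hz)]
  refine ⟨R + |f R| / c, by have : 0 ≤ |f R| / c := by positivity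
                            linarith, ?_⟩
  have h := hanti Set.self_mem_Ici (show R + |f R| / c ∈ Set.Ici R by
    have : 0 ≤ |f R| / c := by positivity
    simpa using this) (by have : 0 ≤ |f R| / c := by positivity
                          linarith)
  have e : c * (R + |f R| / c) = c * R + |f R| := by field_simp
  simp only [e] at h
  linarith [le_abs_self (f R)]

theorem exists_inv_cosh_sq_le {l : ℝ} (hl : 0 < l) :
    ∃ R : ℝ, 0 ≤ R ∧ ∀ z, R ≤ z → 1 / cosh z ^ 2 ≤ l := by
  obtain ⟨R, hR⟩ := eventually_atTop.1 (tendsto_inv_cosh_sq_atTop.eventually_lt_const hl)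
  exact ⟨max R 0, le_max_right _ _, fun z hz => (hR z ((le_max_left _ _).trans hz)).le⟩

/-! ### Behaviour at infinity and comparison of energies. -/

/-- `ψ` and `u = ψ' / cosh²` solve the system equivalent to `D ψ = -l ψ`. -/
structure IsCatenoidSolution (l : ℝ) (ψ u : ℝ → ℝ) : Prop where
  hasDerivAt_fst : ∀ z, HasDerivAt ψ (cosh z ^ 2 * u z) z
  hasDerivAt_snd : ∀ z, HasDerivAt u ((l - 1 / cosh z ^ 2) * ψ z) z

namespace IsCatenoidSolution

variable {l : ℝ} {ψ u : ℝ → ℝ}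

theorem continuous_fst (h : IsCatenoidSolution l ψ u) : Continuous ψ :=
  continuous_iff_continuousAt.2 fun z => (h.hasDerivAt_fst z).continuousAt

theorem continuous_snd (h : IsCatenoidSolution l ψ u) : Continuous u :=
  continuous_iff_continuousAt.2 fun z => (h.hasDerivAt_snd z).continuousAt

theorem monotoneOn_mul (h : IsCatenoidSolution l ψ u) {R : ℝ}
    (hR : ∀ z, R ≤ z → 1 / cosh z ^ 2 ≤ l) : MonotoneOn (fun z => ψ z * u z) (Set.Ici R) := by
  have hd : ∀ z, HasDerivAt (fun z => ψ z * u z)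
      ((cosh z * u z) ^ 2 + (l - 1 / cosh z ^ 2) * ψ z ^ 2) z := fun z =>
    ((h.hasDerivAt_fst z).mul (h.hasDerivAt_snd z)).congr_deriv (by ring)
  refine monotoneOn_of_hasDerivWithinAt_nonneg (convex_Ici R)
    (fun z _ => (hd z).continuousAt.continuousWithinAt)
    (fun z _ => (hd z).hasDerivWithinAt) fun z hz => ?_
  rw [interior_Ici] at hz
  have := sub_nonneg.2 (hR z (le_of_lt hz))
  positivity

theorem hasDerivAt_sq (h : IsCatenoidSolution l ψ u) (z : ℝ) :
    HasDerivAt (fun z => ψ z ^ 2) (2 * cosh z ^ 2 * (ψ z * u z)) z := by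
  refine ((h.hasDerivAt_fst z).pow 2).congr_deriv ?_
  simp
  ring

theorem monotoneOn_sq (h : IsCatenoidSolution l ψ u) {R : ℝ}
    (hR : ∀ z, R ≤ z → 0 ≤ ψ z * u z) : MonotoneOn (fun z => ψ z ^ 2) (Set.Ici R) := by
  refine monotoneOn_of_hasDerivWithinAt_nonneg (convex_Ici R)
    (fun z _ => (h.hasDerivAt_sq z).continuousAt.continuousWithinAt)
    (fun z _ => (h.hasDerivAt_sq z).hasDerivWithinAt) fun z hz => ?_
  rw [interior_Ici] at hz
  have := hR z (le_of_lt hz)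
  positivity

theorem antitoneOn_fst (h : IsCatenoidSolution l ψ u) {R : ℝ}
    (hR : ∀ z, R ≤ z → u z ≤ 0) : AntitoneOn ψ (Set.Ici R) := by
  refine antitoneOn_of_hasDerivWithinAt_nonpos (convex_Ici R) h.continuous_fst.continuousOn
    (fun z _ => (h.hasDerivAt_fst z).hasDerivWithinAt) fun z hz => ?_
  rw [interior_Ici] at hz
  exact mul_nonpos_of_nonneg_of_nonpos (by positivity) (hR z (le_of_lt hz))

theorem monotoneOn_snd (h : IsCatenoidSolution l ψ u) {R : ℝ}
    (hR : ∀ z, R ≤ z → 1 / cosh z ^ 2 ≤ l) (hpos : ∀ z, R ≤ z → 0 < ψ z) :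
    MonotoneOn u (Set.Ici R) := by
  refine monotoneOn_of_hasDerivWithinAt_nonneg (convex_Ici R) h.continuous_snd.continuousOn
    (fun z _ => (h.hasDerivAt_snd z).hasDerivWithinAt) fun z hz => ?_
  rw [interior_Ici] at hz
  exact mul_nonneg (sub_nonneg.2 (hR z (le_of_lt hz))) (hpos z (le_of_lt hz)).le

/-- If `u z > 0`, the product `ψ u` stays positive beyond `z`, so `ψ²` is nondecreasing there and
cannot be integrable. -/
theorem snd_nonpos (h : IsCatenoidSolution l ψ u) (hL : MemLp ψ 2) {R : ℝ}
    (hR : ∀ z, R ≤ z → 1 / cosh z ^ 2 ≤ l) (hpos : ∀ z, R ≤ z → 0 < ψ z) {z : ℝ} (hz : R ≤ z) :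
    u z ≤ 0 := by
  by_contra hcon
  have hm : ∀ x, z ≤ x → 0 ≤ ψ x * u x := fun x hx =>
    (mul_pos (hpos z hz) (not_le.1 hcon)).le.trans
      (h.monotoneOn_mul hR hz (hz.trans hx) hx)
  have := hpos z hz
  exact not_integrable_of_pos_le (c := ψ z ^ 2) (R := z) (by positivity)
    (fun x hx => h.monotoneOn_sq hm Set.self_mem_Ici hx hx) hL.integrable_sq

/-- Beyond `R`, `u` is nondecreasing and nonpositive. Staying below some `c < 0` would give `ψ' =
cosh² u ≤ c`, driving `ψ` to a nonpositive value. -/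
theorem tendsto_snd (h : IsCatenoidSolution l ψ u) {R : ℝ}
    (hR : ∀ z, R ≤ z → 1 / cosh z ^ 2 ≤ l) (hpos : ∀ z, R ≤ z → 0 < ψ z)
    (hu : ∀ z, R ≤ z → u z ≤ 0) : Tendsto u atTop (𝓝 0) := by
  refine (tendsto_order.2 ⟨fun c hc => ?_, fun c hc => ?_⟩)
  · by_contra hcon
    have hfreq : ∀ z, R ≤ z → u z ≤ c := fun z hz => by
      by_contra hz'
      refine hcon ?_
      filter_upwards [eventually_ge_atTop z] with x hx
      exact (not_le.1 hz').trans_le (h.monotoneOn_snd hR hpos hz (hz.trans hx) hx)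
    obtain ⟨z, hz, hz0⟩ := exists_nonpos_of_deriv_le (neg_pos.2 hc) h.hasDerivAt_fst
      (R := R) fun z hz => by
        have h1 := hfreq z hz
        have h2 : 1 ≤ cosh z ^ 2 := one_le_pow₀ (one_le_cosh z)
        nlinarith
    exact absurd (hpos z hz) (not_lt.2 hz0)
  · filter_upwards [eventually_ge_atTop R] with z hz
    exact (hu z hz).trans_lt hc

theorem not_lt_of_pos {l' : ℝ} {φ v : ℝ → ℝ} (h : IsCatenoidSolution l ψ u)
    (h' : IsCatenoidSolution l' φ v) (hl : 0 < l) (hψ : ∀ z, 0 < ψ z) (hφ : ∀ z, 0 < φ z)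
    (hψL : MemLp ψ 2) (hφL : MemLp φ 2) (hu : u 0 = 0) (hv : v 0 = 0) : ¬ l < l' := by
  intro hll
  obtain ⟨R, -, hR⟩ := exists_inv_cosh_sq_le hl
  have hR' : ∀ z, R ≤ z → 1 / cosh z ^ 2 ≤ l' := fun z hz => (hR z hz).trans hll.le
  have hu0 : ∀ z, R ≤ z → u z ≤ 0 := fun z hz => h.snd_nonpos hψL hR (fun z _ => hψ z) hz
  have hv0 : ∀ z, R ≤ z → v z ≤ 0 := fun z hz => h'.snd_nonpos hφL hR' (fun z _ => hφ z) hz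
  have tu := h.tendsto_snd hR (fun z _ => hψ z) hu0
  have tv := h'.tendsto_snd hR' (fun z _ => hφ z) hv0
  have bdd : ∀ {f : ℝ → ℝ}, (∀ z, 0 < f z) → AntitoneOn f (Set.Ici R) →
      IsBoundedUnder (· ≤ ·) atTop (norm ∘ f) := fun {f} hf ha =>
    isBoundedUnder_of_eventually_le (a := f R) (by
      filter_upwards [eventually_ge_atTop R] with z hz
      simp only [Function.comp, norm_of_nonneg (hf z).le]
      exact ha Set.self_mem_Ici hz hz)
  have t1 : Tendsto (fun z => v z * ψ z) atTop (𝓝 0) :=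
    tv.zero_mul_isBoundedUnder_le (bdd hψ (h.antitoneOn_fst hu0))
  have t2 : Tendsto (fun z => u z * φ z) atTop (𝓝 0) :=
    tu.zero_mul_isBoundedUnder_le (bdd hφ (h'.antitoneOn_fst hv0))
  -- The Wronskian is zero at `0` and strictly increasing when `l < l'`, yet its limit at infinity
  -- is zero because `u, v → 0` while `ψ, φ` stay bounded.
  have hd : ∀ z, HasDerivAt (fun z => v z * ψ z - u z * φ z) ((l' - l) * (ψ z * φ z)) z :=
    fun z => (((h'.hasDerivAt_snd z).mul (h.hasDerivAt_fst z)).sub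
      ((h.hasDerivAt_snd z).mul (h'.hasDerivAt_fst z))).congr_deriv (by ring)
  have hmono : StrictMono fun z => v z * ψ z - u z * φ z :=
    strictMono_of_hasDerivAt_pos hd fun z =>
      mul_pos (sub_pos.2 hll) (mul_pos (hψ z) (hφ z))
  have hlim := t1.sub t2
  rw [sub_zero] at hlim
  have h1 := hmono (zero_lt_one (α := ℝ))
  have h2 := hmono.monotone.ge_of_tendsto hlim 1
  simp only [hu, hv] at h1
  linarith

end IsCatenoidSolution

/-! ### Uniqueness of the negative even eigenfunction. -/

theorem InDomainD.neg {ψ : ℝ → ℝ} (h : InDomainD ψ) : InDomainD (-ψ) ∧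
    catenoidD (-ψ) = -catenoidD ψ := by
  have e : catenoidD (-ψ) = -catenoidD ψ := by
    funext z
    have h1 : deriv (-ψ) = -deriv ψ := funext fun x => deriv.neg
    have h2 : deriv (-deriv ψ) z = -deriv (deriv ψ) z := deriv.neg
    simp only [catenoidD, h1, h2, Pi.neg_apply]
    ring
  exact ⟨⟨h.contDiff.neg, h.memLp.neg, e ▸ h.memLp_D.neg⟩, e⟩

theorem IsEigenfunctionD.neg {E : ℝ} {ψ : ℝ → ℝ} (h : IsEigenfunctionD E ψ) :
    IsEigenfunctionD E (-ψ) where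
  inDomain := h.inDomain.neg.1
  ne_zero := neg_ne_zero.2 h.ne_zero
  eigen z := by
    rw [h.inDomain.neg.2, Pi.neg_apply, h.eigen, Pi.neg_apply]
    ring

theorem IsEigenfunctionD.isCatenoidSolution {E : ℝ} {ψ : ℝ → ℝ} (h : IsEigenfunctionD E ψ) :
    IsCatenoidSolution (-E) ψ fun z => deriv ψ z / cosh z ^ 2 where
  hasDerivAt_fst z := (h.inDomain.contDiff.hasDerivAt_catenoidSystem h.eigen z).fst
  hasDerivAt_snd z := (h.inDomain.contDiff.hasDerivAt_catenoidSystem h.eigen z).snd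

theorem IsEigenfunctionD.exists_pos {E : ℝ} {ψ : ℝ → ℝ} (h : IsEigenfunctionD E ψ)
    (hE : E < 0) (he : Function.Even ψ) :
    ∃ φ, IsEigenfunctionD E φ ∧ Function.Even φ ∧ ∀ z, 0 < φ z := by
  have key : ∀ φ, IsEigenfunctionD E φ → Function.Even φ → 0 < φ 0 → ∀ z, 0 < φ z := by
    intro φ hφ hφe h0 z
    have : 0 < φ |z| := hφ.inDomain.contDiff.continuous.pos_of_ne_zero h0
      (fun z _ => hφ.ne_zero_of_even hE hφe z) (abs_nonneg z)
    rcases abs_choice z with h | h <;> rw [h] at this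
    · exact this
    · rwa [hφe z] at this
  rcases (h.ne_zero_of_even hE he 0).lt_or_gt with h0 | h0
  · have hne : Function.Even (-ψ) := fun z => by simp [he z]
    exact ⟨-ψ, h.neg, hne, key _ h.neg hne (by simpa using h0)⟩
  · exact ⟨ψ, h, he, key ψ h he h0⟩

theorem IsEigenfunctionD.energy_unique {E E' : ℝ} {ψ φ : ℝ → ℝ} (h : IsEigenfunctionD E ψ)
    (h' : IsEigenfunctionD E' φ) (hE : E < 0) (hE' : E' < 0) (he : Function.Even ψ)
    (he' : Function.Even φ) : E = E' := by
  obtain ⟨ψ, hψ, hψe, hψ0⟩ := h.exists_pos hE he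
  obtain ⟨φ, hφ, hφe, hφ0⟩ := h'.exists_pos hE' he'
  have h1 := hψ.isCatenoidSolution.not_lt_of_pos hφ.isCatenoidSolution (neg_pos.2 hE) hψ0 hφ0
    hψ.inDomain.memLp hφ.inDomain.memLp (by simp [hψe.deriv_zero]) (by simp [hφe.deriv_zero])
  have h2 := hφ.isCatenoidSolution.not_lt_of_pos hψ.isCatenoidSolution (neg_pos.2 hE') hφ0 hψ0
    hφ.inDomain.memLp hψ.inDomain.memLp (by simp [hφe.deriv_zero]) (by simp [hψe.deriv_zero])
  linarith

theorem IsEigenfunctionD.exists_eq_smul {E : ℝ} {ψ φ : ℝ → ℝ} (h : IsEigenfunctionD E ψ)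
    (h' : IsEigenfunctionD E φ) (hE : E < 0) (he : Function.Even ψ) (he' : Function.Even φ) :
    ∃ c : ℝ, φ = c • ψ := by
  have hψ := h.ne_zero_of_even hE he
  have s := h.isCatenoidSolution
  have s' := h'.isCatenoidSolution
  refine ⟨φ 0 / ψ 0, ?_⟩
  have hy : ∀ z, HasDerivAt (fun z => (φ z - φ 0 / ψ 0 * ψ z,
      deriv φ z / cosh z ^ 2 - φ 0 / ψ 0 * (deriv ψ z / cosh z ^ 2)))
      (catenoidSystem (-E) z (φ z - φ 0 / ψ 0 * ψ z,
        deriv φ z / cosh z ^ 2 - φ 0 / ψ 0 * (deriv ψ z / cosh z ^ 2))) z := fun z => by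
    refine (((s'.hasDerivAt_fst z).sub ((s.hasDerivAt_fst z).const_mul _)).prodMk
      ((s'.hasDerivAt_snd z).sub ((s.hasDerivAt_snd z).const_mul _))).congr_deriv ?_
    rw [catenoidSystem_apply]
    ext <;> simp only <;> ring
  have := eq_zero_of_hasDerivAt_linear (continuous_catenoidSystem (-E)) hy (t₀ := 0)
    (by simp [hψ 0, he.deriv_zero, he'.deriv_zero])
  funext z
  have := congrArg Prod.fst (congrFun this z)
  simp only [Pi.zero_apply, Prod.fst_zero, sub_eq_zero] at this
  simpa using this

/-! ### The family of even solutions. -/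

theorem exists_catenoidSystem_solution (l : ℝ) : ∃ y : ℝ → ℝ × ℝ, y 0 = (1, 0) ∧
    ∀ t, HasDerivAt y (catenoidSystem l t (y t)) t :=
  exists_forall_hasDerivAt_linear (continuous_catenoidSystem l) (1, 0)

/-- The solution of `D ψ = -l ψ` with `ψ 0 = 1`, `ψ' 0 = 0`, paired with `ψ' / cosh²`. -/
noncomputable def evenSolution (l : ℝ) : ℝ → ℝ × ℝ :=
  (exists_catenoidSystem_solution l).choose

theorem evenSolution_zero (l : ℝ) : evenSolution l 0 = (1, 0) :=
  (exists_catenoidSystem_solution l).choose_spec.1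

theorem hasDerivAt_evenSolution (l t : ℝ) :
    HasDerivAt (evenSolution l) (catenoidSystem l t (evenSolution l t)) t :=
  (exists_catenoidSystem_solution l).choose_spec.2 t

theorem isCatenoidSolution_evenSolution (l : ℝ) :
    IsCatenoidSolution l (fun z => (evenSolution l z).1) (fun z => (evenSolution l z).2) where
  hasDerivAt_fst z := (hasDerivAt_evenSolution l z).fst
  hasDerivAt_snd z := (hasDerivAt_evenSolution l z).snd

theorem eventually_abs_evenSolution_sub_lt (l₀ R : ℝ) {η : ℝ} (hη : 0 < η) :
    ∀ᶠ l in 𝓝 l₀, ∀ t ∈ Set.Icc 0 R,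
      |(evenSolution l t).1 - (evenSolution l₀ t).1| < η ∧
        |(evenSolution l t).2 - (evenSolution l₀ t).2| < η := by
  filter_upwards [eventually_dist_lt_of_hasDerivAt_linear (A := catenoidSystem)
    (continuous_catenoidSystem l₀) (fun l t => norm_catenoidSystem_sub_le l l₀ t)
    evenSolution_zero hasDerivAt_evenSolution R hη] with l hl t ht
  have := hl t ht
  rwa [Prod.dist_eq, max_lt_iff, Real.dist_eq, Real.dist_eq] at this

theorem even_evenSolution (l : ℝ) : Function.Even fun z => (evenSolution l z).1 := by
  have s := isCatenoidSolution_evenSolution l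
  have hn : ∀ {f : ℝ → ℝ} {f' z : ℝ}, HasDerivAt f f' (-z) →
      HasDerivAt (fun x => f (-x)) (-f') z := fun h =>
    (HasDerivAt.comp _ h (hasDerivAt_neg _)).congr_deriv (by simp)
  -- Reflection sends `(ψ, u)` to `(ψ(-z), -u(-z))`, again a solution; the difference has zero
  -- Cauchy data at `0`.
  have hy : ∀ z, HasDerivAt (fun z => ((evenSolution l z).1 - (evenSolution l (-z)).1,
      (evenSolution l z).2 + (evenSolution l (-z)).2))
      (catenoidSystem l z ((evenSolution l z).1 - (evenSolution l (-z)).1,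
      (evenSolution l z).2 + (evenSolution l (-z)).2)) z := fun z => by
    refine (((s.hasDerivAt_fst z).sub (hn (s.hasDerivAt_fst (-z)))).prodMk
      ((s.hasDerivAt_snd z).add (hn (s.hasDerivAt_snd (-z))))).congr_deriv ?_
    rw [catenoidSystem_apply, cosh_neg]
    ext <;> simp only <;> ring
  have := eq_zero_of_hasDerivAt_linear (continuous_catenoidSystem l) hy (t₀ := 0)
    (by simp [evenSolution_zero])
  intro z
  have := congrArg Prod.fst (congrFun this z)
  simp only [Pi.zero_apply, Prod.fst_zero, sub_eq_zero] at this
  exact this.symm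

/-! ### Positive solutions: regularity, the bound `8/15 ≤ l`, square integrability. -/

namespace IsCatenoidSolution

variable {l : ℝ} {ψ u : ℝ → ℝ}

theorem contDiff_fst (h : IsCatenoidSolution l ψ u) : ContDiff ℝ 2 ψ := by
  have hu : ContDiff ℝ 1 u := by
    refine contDiff_one_iff_deriv.2 ⟨fun z => (h.hasDerivAt_snd z).differentiableAt, ?_⟩
    rw [show deriv u = fun z => (l - 1 / Real.cosh z ^ 2) * ψ z from
      funext fun z => (h.hasDerivAt_snd z).deriv]
    exact (continuous_const.sub continuous_inv_cosh_sq).mul h.continuous_fst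
  have hd : deriv ψ = fun z => Real.cosh z ^ 2 * u z :=
    funext fun z => (h.hasDerivAt_fst z).deriv
  have : ContDiff ℝ (1 + 1) ψ := by
    refine contDiff_succ_iff_deriv.2 ⟨fun z => (h.hasDerivAt_fst z).differentiableAt, ?_, ?_⟩
    · simp
    · rw [hd]
      exact (Real.contDiff_cosh.pow 2).mul hu
  exact this

theorem catenoidD_eq (h : IsCatenoidSolution l ψ u) (z : ℝ) :
    catenoidD ψ z = -l * ψ z := by
  rw [catenoidD_eq_of_hasDerivAt h.hasDerivAt_fst
    (((hasDerivAt_cosh z).pow 2).mul (h.hasDerivAt_snd z)), tanh_eq_sinh_div_cosh]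
  have hc := (cosh_pos z).ne'
  simp only [Pi.pow_apply]
  field_simp
  push_cast
  ring

theorem isEigenfunctionD (h : IsCatenoidSolution l ψ u) (h0 : ψ ≠ 0) (hL : MemLp ψ 2) :
    IsEigenfunctionD (-l) ψ := by
  have hD := h.catenoidD_eq
  refine ⟨⟨h.contDiff_fst, hL, ?_⟩, h0, hD⟩
  rw [show catenoidD ψ = (-l) • ψ from funext hD]
  exact hL.const_smul (-l)

theorem pos_of_mul_pos (h : IsCatenoidSolution l ψ u) {R : ℝ}
    (hR : ∀ z, R ≤ z → 1 / cosh z ^ 2 ≤ l) (hψ : 0 < ψ R) (hu : 0 < u R) {z : ℝ} (hz : R ≤ z) :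
    0 < ψ z :=
  h.continuous_fst.pos_of_ne_zero hψ (fun _ hx => left_ne_zero_of_mul
    ((mul_pos hψ hu).trans_le (h.monotoneOn_mul hR Set.self_mem_Ici hx hx)).ne') hz

theorem pos_of_one_le (h : IsCatenoidSolution l ψ u) (hl : 1 ≤ l) (hψ : 0 < ψ 0) (hu : u 0 = 0)
    {z : ℝ} (hz : 0 ≤ z) : 0 < ψ z := by
  have hm : ∀ x, 0 ≤ x → 0 ≤ ψ x * u x := fun x hx => by
    have := h.monotoneOn_mul (R := 0) (fun z _ => (inv_cosh_sq_le_one z).trans hl)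
      Set.self_mem_Ici hx hx
    simpa [hu] using this
  refine h.continuous_fst.pos_of_ne_zero hψ (fun x hx => ?_) hz
  have := h.monotoneOn_sq hm Set.self_mem_Ici hx hx
  exact (pow_ne_zero_iff two_ne_zero).1 ((by positivity : 0 < ψ 0 ^ 2).trans_le this).ne'

/-- Where `u + ψ ≤ 0`, one has `cosh² u ≤ u ≤ -ψ`, so `(u + ψ)' ≤ (l - 1 - 1 / cosh²) ψ < 0`. The
inequality thus persists with a strictly decreasing sum, `ψ'` stays below a negative constant, and
`ψ` loses positivity. -/
theorem neg_fst_lt_snd (h : IsCatenoidSolution l ψ u) (hl : l < 1)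
    (hpos : ∀ z, 0 ≤ z → 0 < ψ z) {z : ℝ} (hz : 0 ≤ z) : -ψ z < u z := by
  by_contra hcon
  have hd : ∀ x, HasDerivAt (fun x => u x + ψ x)
      ((l - 1 / cosh x ^ 2) * ψ x + cosh x ^ 2 * u x) x := fun x =>
    (h.hasDerivAt_snd x).add (h.hasDerivAt_fst x)
  have hc2 : ∀ x : ℝ, 1 ≤ cosh x ^ 2 := fun x => one_le_pow₀ (one_le_cosh x)
  have hp : ∀ x : ℝ, 0 < 1 / cosh x ^ 2 := fun x => by
    have := cosh_pos x
    positivity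
  have hdneg : ∀ x, 0 ≤ x → u x + ψ x ≤ 0 →
      (l - 1 / cosh x ^ 2) * ψ x + cosh x ^ 2 * u x < 0 := fun x hx hux => by
    have h1 := hpos x hx
    have h2 : cosh x ^ 2 * u x ≤ u x := by nlinarith [hc2 x]
    have h3 := mul_pos (hp x) h1
    nlinarith
  have hw : ∀ x, z ≤ x → u x + ψ x ≤ 0 := fun x hx =>
    image_le_of_deriv_right_lt_deriv_boundary' (f := fun x => u x + ψ x)
      (f' := fun x => (l - 1 / cosh x ^ 2) * ψ x + cosh x ^ 2 * u x) (B := fun _ => 0)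
      (B' := fun _ => 0) (h.continuous_snd.add h.continuous_fst).continuousOn
      (fun y _ => (hd y).hasDerivWithinAt) (by linarith [not_lt.1 hcon]) continuousOn_const
      (fun y _ => hasDerivWithinAt_const _ _ _)
      (fun y hy hy0 => hdneg y (hz.trans hy.1) hy0.le) ⟨hx, le_rfl⟩
  have hanti : StrictAntiOn (fun x => u x + ψ x) (Set.Ici z) := by
    refine strictAntiOn_of_hasDerivWithinAt_neg (convex_Ici z)
      (h.continuous_snd.add h.continuous_fst).continuousOn
      (fun x _ => (hd x).hasDerivWithinAt) fun x hx => ?_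
    rw [interior_Ici] at hx
    exact hdneg x (hz.trans (le_of_lt hx)) (hw x (le_of_lt hx))
  have hz1 : z + 1 ∈ Set.Ici z := by simp
  have hneg : u (z + 1) + ψ (z + 1) < 0 :=
    (hanti Set.self_mem_Ici hz1 (lt_add_one z)).trans_le (hw z le_rfl)
  obtain ⟨x, hx, hx0⟩ := exists_nonpos_of_deriv_le (neg_pos.2 hneg) h.hasDerivAt_fst
    (R := z + 1) fun x hx => by
      have hxz : z ≤ x := by linarith
      have h1 := hanti.antitoneOn hz1 hxz hx
      have h2 := hpos x (hz.trans hxz)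
      have h3 := hc2 x
      nlinarith
  exact absurd (hpos x (by linarith)) (not_lt.2 hx0)

/-- Jacobi's identity with trial function `χ = 1 / cosh` and `w = u / ψ`: the form density `χ'² /
cosh² + (l - 1 / cosh²) χ²` minus `(w χ²)'` is a perfect square. Integrating from `0`, with `w > -1`
making the boundary term negligible, gives `l - 8/15 ≥ 0`. -/
theorem le_of_pos (h : IsCatenoidSolution l ψ u) (hu : u 0 = 0)
    (hpos : ∀ z, 0 ≤ z → 0 < ψ z) : 8 / 15 ≤ l := by
  rcases le_or_gt 1 l with hl | hl
  · linarith
  -- `F` is the primitive, zero at `0`, of the form density `l / cosh² - 1 / cosh⁶`; its limit is `l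
  -- - 1 + 2/3 - 1/5 = l - 8/15`.
  set F : ℝ → ℝ := fun x => (l - 1) * tanh x + 2 / 3 * tanh x ^ 3 + -(1 / 5) * tanh x ^ 5 with hF
  have hd : ∀ z, 0 ≤ z → HasDerivAt (fun z => F z - u z / ψ z * (1 / cosh z) ^ 2)
      ((u z / ψ z + 1 / cosh z ^ 2 * tanh z) ^ 2) z := fun z hz => by
    have hψ := (hpos z hz).ne'
    have hc := (cosh_pos z).ne'
    refine ((hasDerivAt_tanh_polynomial (l - 1) (2 / 3) (-(1 / 5)) z).sub
      (((h.hasDerivAt_snd z).div (h.hasDerivAt_fst z) hψ).mul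
        ((hasDerivAt_inv_cosh z).pow 2))).congr_deriv ?_
    have hsq : sinh z ^ 2 = cosh z ^ 2 - 1 := by linarith [cosh_sq z]
    have h4 : sinh z ^ 4 = (cosh z ^ 2 - 1) ^ 2 := by rw [← hsq]; ring
    simp only [Pi.div_apply, Pi.pow_apply, tanh_eq_sinh_div_cosh, Nat.add_one_sub_one, pow_one]
    field_simp
    push_cast
    ring_nf
    simp only [hsq, h4]
    ring
  have hmono : MonotoneOn (fun z => F z - u z / ψ z * (1 / cosh z) ^ 2) (Set.Ici 0) := by
    refine monotoneOn_of_hasDerivWithinAt_nonneg (convex_Ici 0)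
      (fun z hz => (hd z hz).continuousAt.continuousWithinAt)
      (fun z hz => (hd z (interior_subset hz)).hasDerivWithinAt) fun z _ => sq_nonneg _
  have hlow : ∀ z, 0 ≤ z → -(1 / cosh z ^ 2) ≤ F z := fun z hz => by
    have h1 := hmono Set.self_mem_Ici hz hz
    have h2 := h.neg_fst_lt_snd hl hpos hz
    have h3 : -1 ≤ u z / ψ z := by
      rw [le_div_iff₀ (hpos z hz)]
      linarith
    have h4 : 0 < 1 / cosh z ^ 2 := by
      have := cosh_pos z
      positivity
    have hF0 : F 0 = 0 := by simp [hF]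
    simp only [hF0, hu, zero_div, zero_mul, sub_zero, one_div_pow] at h1
    nlinarith
  have hlim : Tendsto F atTop (𝓝 ((l - 1) * 1 + 2 / 3 * 1 ^ 3 + -(1 / 5) * 1 ^ 5)) :=
    ((tendsto_tanh_atTop.const_mul _).add ((tendsto_tanh_atTop.pow 3).const_mul _)).add
      ((tendsto_tanh_atTop.pow 5).const_mul _)
  have := le_of_tendsto_of_tendsto tendsto_inv_cosh_sq_atTop.neg hlim
    ((eventually_ge_atTop 0).mono hlow)
  norm_num at this
  linarith

/-- Since `ψ` is nonincreasing and `l - 1 / cosh² ≥ l / 2`, one has `ψ² ≤ ψ R * (2 / l) * u'`. The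
integral of `u'` over `[R, b]` is at most `-u R` because `u ≤ 0`. -/
theorem integrableOn_sq (h : IsCatenoidSolution l ψ u) (hl : 0 < l) {R : ℝ}
    (hR : ∀ z, R ≤ z → 1 / cosh z ^ 2 ≤ l / 2) (hpos : ∀ z, R ≤ z → 0 < ψ z)
    (hu : ∀ z, R ≤ z → u z ≤ 0) : IntegrableOn (fun z => ψ z ^ 2) (Set.Ioi R) := by
  have hc := h.continuous_fst
  have hanti := h.antitoneOn_fst hu
  refine integrableOn_Ioi_of_intervalIntegral_norm_bounded (ψ R * (2 / l) * -u R) R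
    (l := atTop) (b := id)
    (fun b => ((hc.pow 2).locallyIntegrable.integrableOn_isCompact isCompact_Icc).mono_set
      Set.Ioc_subset_Icc_self) tendsto_id ?_
  filter_upwards [eventually_ge_atTop R] with b hb
  have hint : ∀ a b : ℝ, IntervalIntegrable (fun z => (l - 1 / cosh z ^ 2) * ψ z) volume a b :=
    fun a b => ((continuous_const.sub continuous_inv_cosh_sq).mul hc).intervalIntegrable a b
  calc ∫ z in R..b, ‖ψ z ^ 2‖ ≤
        ∫ z in R..b, ψ R * (2 / l) * ((l - 1 / cosh z ^ 2) * ψ z) := by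
        refine intervalIntegral.integral_mono_on hb ((hc.pow 2).norm.intervalIntegrable _ _)
          ((hint _ _).const_mul _) fun z hz => ?_
        have h1 := hpos z hz.1
        have h2 := hanti Set.self_mem_Ici hz.1 hz.1
        have h3 : 1 ≤ 2 / l * (l - 1 / cosh z ^ 2) := by
          have := hR z hz.1
          rw [div_mul_eq_mul_div, le_div_iff₀ hl]
          linarith
        rw [norm_of_nonneg (sq_nonneg _)]
        calc ψ z ^ 2 = ψ z * ψ z := sq _
          _ ≤ ψ R * ψ z := mul_le_mul_of_nonneg_right h2 h1.le
          _ ≤ ψ R * ψ z * (2 / l * (l - 1 / cosh z ^ 2)) :=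
            le_mul_of_one_le_right (mul_pos (hpos R le_rfl) h1).le h3
          _ = _ := by ring
    _ = ψ R * (2 / l) * (u b - u R) := by
        rw [intervalIntegral.integral_const_mul,
          intervalIntegral.integral_eq_sub_of_hasDerivAt (fun z _ => h.hasDerivAt_snd z)
            (hint R b)]
    _ ≤ ψ R * (2 / l) * -u R := by
        have := hpos R le_rfl
        refine mul_le_mul_of_nonneg_left ?_ (by positivity)
        linarith [hu b hb]

end IsCatenoidSolution

/-! ### Shooting in the parameter `l`. -/

theorem Function.Even.integrable_of_integrableOn_Ioi {f : ℝ → ℝ} (he : Function.Even f)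
    (hc : Continuous f) {R : ℝ} (h : IntegrableOn f (Set.Ioi R)) : Integrable f := by
  have h1 : IntegrableOn f (Set.Iio (-R)) := by
    have := ((Measure.measurePreserving_neg (volume : Measure ℝ)).integrableOn_comp_preimage
      (Homeomorph.neg ℝ).measurableEmbedding).2 h
    rw [show f ∘ Neg.neg = f from funext he] at this
    simpa using this
  have h2 : IntegrableOn f (Set.Icc (-R) R) :=
    hc.locallyIntegrable.integrableOn_isCompact isCompact_Icc
  rw [← integrableOn_univ]
  refine ((h1.union h2).union h).mono_set fun z _ => ?_
  simp only [Set.mem_union, Set.mem_Iio, Set.mem_Icc, Set.mem_Ioi]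
  by_contra hcon
  push Not at hcon
  exact absurd (hcon.1.2 hcon.1.1) (not_lt.2 hcon.2)

/-- A nonnegative solution touching zero at `z > 0` has a minimum there, so both components vanish
and the solution would be trivial. -/
theorem evenSolution_pos {l : ℝ} (h : ∀ z, 0 < z → 0 ≤ (evenSolution l z).1) {z : ℝ}
    (hz : 0 ≤ z) : 0 < (evenSolution l z).1 := by
  have s := isCatenoidSolution_evenSolution l
  rcases hz.eq_or_lt with rfl | hz
  · simp [evenSolution_zero]
  refine (h z hz).lt_of_ne fun h0 => ?_
  have hmin : IsLocalMin (fun z => (evenSolution l z).1) z := by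
    filter_upwards [Ioi_mem_nhds hz] with x hx
    rw [← h0]
    exact h x hx
  have hd := hmin.hasDerivAt_eq_zero (s.hasDerivAt_fst z)
  have hu : (evenSolution l z).2 = 0 :=
    (mul_eq_zero.1 hd).resolve_left (pow_pos (cosh_pos z) 2).ne'
  have := eq_zero_of_hasDerivAt_linear (continuous_catenoidSystem l)
    (hasDerivAt_evenSolution l) (t₀ := z) (Prod.ext h0.symm hu)
  have h1 := congrFun this 0
  rw [evenSolution_zero] at h1
  exact one_ne_zero (congrArg Prod.fst h1)

/-- The parameters for which the even solution becomes negative somewhere. -/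
def crossingSet : Set ℝ := {l | 0 < l ∧ ∃ z, 0 < z ∧ (evenSolution l z).1 < 0}

theorem evenSolution_pos_of_notMem {l : ℝ} (hl : 0 < l) (h : l ∉ crossingSet) {z : ℝ}
    (hz : 0 ≤ z) : 0 < (evenSolution l z).1 :=
  evenSolution_pos (fun x hx => not_lt.1 fun hn => h ⟨hl, x, hx, hn⟩) hz

theorem mem_crossingSet_of_lt {l : ℝ} (hl : 0 < l) (h : l < 8 / 15) : l ∈ crossingSet := by
  by_contra hcon
  exact absurd ((isCatenoidSolution_evenSolution l).le_of_pos (by simp [evenSolution_zero])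
    fun z hz => evenSolution_pos_of_notMem hl hcon hz) (not_le.2 h)

theorem lt_one_of_mem_crossingSet {l : ℝ} (h : l ∈ crossingSet) : l < 1 := by
  by_contra hcon
  obtain ⟨-, z, hz, hneg⟩ := h
  exact absurd ((isCatenoidSolution_evenSolution l).pos_of_one_le (not_lt.1 hcon)
    (by simp [evenSolution_zero]) (by simp [evenSolution_zero]) hz.le) (not_lt.2 hneg.le)

theorem eventually_mem_crossingSet {l₀ : ℝ} (h : l₀ ∈ crossingSet) :
    ∀ᶠ l in 𝓝 l₀, l ∈ crossingSet := by
  obtain ⟨hl, z, hz, hneg⟩ := h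
  filter_upwards [eventually_abs_evenSolution_sub_lt l₀ z (neg_pos.2 hneg), eventually_gt_nhds hl]
    with l h1 h2
  exact ⟨h2, z, hz, by linarith [(abs_lt.1 (h1 z ⟨hz.le, le_rfl⟩).1).2]⟩

/-- For `l` near `l₀`, closeness on `[0, R]` keeps `ψ` positive there and `u R > 0`. Past `R`,
monotonicity of `ψ u` prevents any zero. The margin `l₀ / 2` makes one `R` work for all `l > l₀ /
2`. -/
theorem eventually_notMem_crossingSet {l₀ R : ℝ} (hl : 0 < l₀) (hR0 : 0 ≤ R)
    (hR : ∀ z, R ≤ z → 1 / cosh z ^ 2 ≤ l₀ / 2)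
    (hpos : ∀ z, 0 ≤ z → 0 < (evenSolution l₀ z).1) (hu : 0 < (evenSolution l₀ R).2) :
    ∀ᶠ l in 𝓝 l₀, l ∉ crossingSet := by
  have s := isCatenoidSolution_evenSolution l₀
  obtain ⟨x, hx, hmin⟩ := (isCompact_Icc (a := (0 : ℝ)) (b := R)).exists_isMinOn
    ⟨0, le_rfl, hR0⟩ s.continuous_fst.continuousOn
  filter_upwards [eventually_abs_evenSolution_sub_lt l₀ R (lt_min (hpos x hx.1) hu),
    eventually_gt_nhds (half_lt_self hl)] with l h1 h2
  rintro ⟨hl0, z, hz, hneg⟩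
  have hclose : ∀ t ∈ Set.Icc 0 R, 0 < (evenSolution l t).1 := fun t ht => by
    have h4 := (h1 t ht).1.trans_le (min_le_left _ _)
    have h5 : (evenSolution l₀ x).1 ≤ (evenSolution l₀ t).1 := hmin ht
    linarith [(abs_lt.1 h4).1]
  have huR : 0 < (evenSolution l R).2 := by
    have h4 := (h1 R ⟨hR0, le_rfl⟩).2.trans_le (min_le_right _ _)
    linarith [(abs_lt.1 h4).1]
  rcases le_total z R with hzR | hzR
  · exact absurd (hclose z ⟨hz.le, hzR⟩) (not_lt.2 hneg.le)
  · exact absurd ((isCatenoidSolution_evenSolution l).pos_of_mul_pos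
      (fun z hz => (hR z hz).trans h2.le) (hclose R ⟨hR0, le_rfl⟩) huR hzR) (not_lt.2 hneg.le)

theorem exists_even_eigenfunction : ∃ (E : ℝ) (ψ : ℝ → ℝ),
    E ≤ -(8 / 15) ∧ IsEigenfunctionD E ψ ∧ Function.Even ψ := by
  have hne : crossingSet.Nonempty := ⟨1 / 2, mem_crossingSet_of_lt (by norm_num) (by norm_num)⟩
  have hbdd : BddAbove crossingSet := ⟨1, fun l hl => (lt_one_of_mem_crossingSet hl).le⟩
  set l₀ := sSup crossingSet
  have hl : 0 < l₀ := (by norm_num : (0 : ℝ) < 1 / 2).trans_le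
    (le_csSup hbdd (mem_crossingSet_of_lt (by norm_num) (by norm_num)))
  have hnot : l₀ ∉ crossingSet := fun hmem => by
    obtain ⟨l, h1, h2⟩ := (((eventually_mem_crossingSet hmem).filter_mono
      nhdsWithin_le_nhds).and (self_mem_nhdsWithin (s := Set.Ioi l₀))).exists
    exact absurd (le_csSup hbdd h1) (not_le.2 h2)
  have hpos : ∀ z, 0 ≤ z → 0 < (evenSolution l₀ z).1 := fun z hz =>
    evenSolution_pos_of_notMem hl hnot hz
  have s := isCatenoidSolution_evenSolution l₀
  obtain ⟨R, hR0, hR⟩ := exists_inv_cosh_sq_le (half_pos hl)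
  have hu : ∀ z, R ≤ z → (evenSolution l₀ z).2 ≤ 0 := fun z hz => by
    by_contra hcon
    have hev := eventually_notMem_crossingSet hl (hR0.trans hz)
      (fun x hx => hR x (hz.trans hx)) hpos (not_le.1 hcon)
    -- The supremum lies in the closure, so crossing parameters occur arbitrarily near `l₀`.
    exact (mem_closure_iff_frequently.1 (csSup_mem_closure hne hbdd)) hev
  have he := even_evenSolution l₀
  have hint := Function.Even.integrable_of_integrableOn_Ioi
    (f := fun z => (evenSolution l₀ z).1 ^ 2) (fun z => congrArg (· ^ 2) (he z))
    (s.continuous_fst.pow 2)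
    (s.integrableOn_sq hl hR (fun z hz => hpos z (hR0.trans hz)) hu)
  refine ⟨-l₀, fun z => (evenSolution l₀ z).1, ?_, s.isEigenfunctionD (fun h0 => ?_)
    ((memLp_two_iff_integrable_sq s.continuous_fst.aestronglyMeasurable).2 hint), he⟩
  · exact neg_le_neg (s.le_of_pos (by simp [evenSolution_zero]) hpos)
  · exact (hpos 0 le_rfl).ne' (congrFun h0 0)

end

theorem mainTheorem7 :
    -- the static catenoid solves the equation, and the linearization there is `ε̈ + D ε = 0`
    (∀ t z : ℝ, minimalResidual (fun _ x => Real.cosh x) t z = 0) ∧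
    (∀ ε : ℝ → ℝ → ℝ, ContDiff ℝ 2 (fun p : ℝ × ℝ => ε p.1 p.2) → ∀ t z : ℝ,
      HasDerivAt (fun l : ℝ => minimalResidual (fun s x => Real.cosh x + l * ε s x) t z)
        (-Real.cosh z ^ 2 *
          (deriv (deriv (fun s => ε s z)) t + catenoidD (fun x => ε t x) z)) 0) ∧
    -- zero modes
    (∀ z : ℝ, catenoidD (fun x => Real.cosh x - x * Real.sinh x) z = 0) ∧
    (∀ z : ℝ, catenoidD (fun x => Real.sinh x) z = 0) ∧
    -- the factorization, in both forms
    (∀ ε : ℝ → ℝ, ContDiff ℝ 2 ε → ∀ z : ℝ, z ≠ 0 →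
      catenoidD ε z = 1 / Real.cosh z *
        firstOrderFactor 1 (firstOrderFactor (-1) (fun x => 1 / Real.cosh x * ε x)) z ∧
      catenoidD ε z = leftFactor (rightFactor ε) z) ∧
    -- non-negativity on odd functions, positivity on odd eigenfunctions
    (∀ ψ : ℝ → ℝ, InDomainD ψ → Function.Odd ψ → 0 ≤ innerL2 ψ (catenoidD ψ)) ∧
    (∀ (E : ℝ) (ψ : ℝ → ℝ), IsEigenfunctionD E ψ → Function.Odd ψ → 0 < E) ∧
    -- the trial function
    (InDomainD (fun z => 1 / Real.cosh z) ∧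
      innerL2 (fun z => 1 / Real.cosh z) (catenoidD (fun z => 1 / Real.cosh z)) /
        innerL2 (fun z => 1 / Real.cosh z) (fun z => 1 / Real.cosh z) = -(8 / 15)) ∧
    -- exactly one even eigenfunction with negative energy, up to scalar multiples
    (∃ (E : ℝ) (ψ : ℝ → ℝ), E ≤ -(8 / 15) ∧ IsEigenfunctionD E ψ ∧ Function.Even ψ ∧
      ∀ (E' : ℝ) (φ : ℝ → ℝ), E' < 0 → IsEigenfunctionD E' φ → Function.Even φ →
        E' = E ∧ ∃ c : ℝ, φ = c • ψ) := by
  refine ⟨minimalResidual_cosh, fun ε hε t z => hasDerivAt_minimalResidual hε t z,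
    catenoidD_cosh_sub, catenoidD_sinh,
    fun ε hε z hz => ⟨catenoidD_eq_firstOrderFactor hε hz, catenoidD_eq_leftFactor hε hz⟩,
    fun ψ hψ ho => innerL2_catenoidD_nonneg_of_odd hψ ho,
    fun E ψ h ho => h.energy_pos_of_odd ho, ⟨inDomainD_inv_cosh, ?_⟩, ?_⟩
  · rw [innerL2_inv_cosh_catenoidD, innerL2_inv_cosh_self]
    norm_num
  · obtain ⟨E, ψ, hE, hψ, he⟩ := exists_even_eigenfunction
    have hE0 : E < 0 := hE.trans_lt (by norm_num)
    refine ⟨E, ψ, hE, hψ, he, fun E' φ hE' hφ he' => ?_⟩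
    obtain rfl := hφ.energy_unique hψ hE' hE0 he' he
    exact ⟨rfl, hψ.exists_eq_smul hφ hE0 he he'⟩
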